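/- Let $N\ge 1$, $1<\alpha<2$, $T>0$, and let $\Omega\subset\mathbb R^N$ be a bounded open set (for example a bounded domain with smooth boundary), with closure $\overline\Omega$ and boundary $\partial\Omega$. Let $A=(a_{ij})$ be a real $N\times N$ matrix function with $a_{ij}\in C^1(\Omega)\cap C(\overline\Omega)$, symmetric on $\Omega$ and uniformly elliptic: for some constant $\delta>0$, $\sum_{i,j}a_{ij}(x)\xi_i\xi_j\ge\delta|\xi|^2$ for all $x\in\Omega$, $\xi\in\mathbb R^N$. Let $c\in C(\overline\Omega)$, $c\ge 0$ on $\Omega$, put $Lv=\operatorname{div}(A\nabla v)-cv$, and let $f\in C[0,T]$. For a function $u$ whose time derivative $u_t$ (one-sided at $t=0,T$) exists and is continuous on $[0,T]$, let $$\partial_t^\alpha u(t,x)=\frac{1}{\Gamma(2-\alpha)}\frac{\partial}{\partial t}\int_0^t\frac{u_\tau(\tau,x)-u_\tau(0,x)}{(t-\tau)^{\alpha-1}}\,d\tau$$ be its Caputo derivative of order $\alpha$. (If $u_t(\cdot,x)$ is absolutely continuous on $[0,T]$ and the following integral coincides for $t\in(0,T]$ with a continuous function on $[0,T]$, then $\partial_t^\alpha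 u(t,x)=\frac{1}{\Gamma(2-\alpha)}\int_0^t\frac{u_{\tau\tau}(\tau,x)}{(t-\tau)^{\alpha-1}}\,d\tau$ for $t\in(0,T]$.) Let $C^{\alpha,2}_{t,x}([0,T]\times\overline\Omega)$ be the class of functions $u$ such that $u$ and $u_t$ are continuous on $[0,T]\times\overline\Omega$, and $\partial_t^\alpha u$ and all second order partial derivatives $u_{x_ix_j}$ exist on $(0,T]\times\Omega$, with $u(t,\cdot)\in C^2(\Omega)$ for every $t\in(0,T]$, and extend continuously to $[0,T]\times\overline\Omega$. Inverse Problem 2: given $L$, $\alpha$, $f$ and functions $\varphi,\psi,\omega$ on $\overline\Omega$, find a pair $\{u,h\}$ with $u\in C^{\alpha,2}_{t,x}([0,T]\times\overline\Omega)$ and $h\in C(\overline\Omega)$ such that $$\partial_t^\alpha u-Lu=f(t)h(x)\quad\text{on }(0,T]\times\Omega,$$ $$u(0,x)=\varphi(x),\quad u_t(0,x)=\psi(x)\quad(x\in\overline\Omega),\qquad u(t,x)=0\quad(t\in[0,T],\ x\in\partial\Omega),$$ $$\int_0^T f(t)\,u_t(t,x)\,dt=\omega(x)\quad(x\in\overline\Omega).$$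 Theorem. Suppose that $f$ is not identically zero on $[0,T]$ (in particular, this holds if $f(t)\ne 0$ for all $t\in[0,T]$). Then Inverse Problem 2 has at most one solution: if $\{u_1,h_1\}$ and $\{u_2,h_2\}$ are solutions with the same data, then $u_1=u_2$ on $[0,T]\times\overline\Omega$ and $h_1=h_2$ on $\overline\Omega$. -/

import Mathlib

open Set MeasureTheory

namespace FracWave

/-- The Riemann-Liouville fractional integral
`(I_{0+}^μ g)(t) = Γ(μ)⁻¹ ∫₀ᵗ g(τ) / (t - τ)^(1-μ) dτ`. -/
noncomputable def rlIntegral (μ : ℝ) (g : ℝ → ℝ) (t : ℝ) : ℝ :=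
  (Real.Gamma μ)⁻¹ * ∫ τ in (0 : ℝ)..t, g τ / (t - τ) ^ (1 - μ)

/-- The time derivative `u_t` on the closed interval `[0, T]` (one-sided at the end points). -/
noncomputable def timeDeriv {E : Type*} (T : ℝ) (u : ℝ → E → ℝ) (t : ℝ) (x : E) : ℝ :=
  derivWithin (fun s => u s x) (Icc 0 T) t

/-- The `(2-α)`-fold fractional integral of `u_t(·, x) - u_t(0, x)`, whose `t`-derivative is the
Caputo derivative of order `α ∈ (1, 2)`. -/
noncomputable def caputoPrimitive {E : Type*} (α T : ℝ) (u : ℝ → E → ℝ) (x : E) (t : ℝ) : ℝ :=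
  rlIntegral (2 - α) (fun τ => timeDeriv T u τ x - timeDeriv T u 0 x) t

/-- The Caputo derivative `∂_t^α u`, `1 < α < 2`, in the form
`d/dt I_{0+}^{2-α} (u_t - u_t(0))`, which needs no second time derivative of `u`. By
`hasDerivWithinAt_caputoPrimitive` below it is `I_{0+}^{2-α} u_tt` whenever `u_t(·, x)` is
absolutely continuous on `[0, T]` and the latter function is continuous in `t`. -/
noncomputable def caputo {E : Type*} (α T : ℝ) (u : ℝ → E → ℝ) (t : ℝ) (x : E) : ℝ :=
  derivWithin (caputoPrimitive α T u x) (Icc 0 T) t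

/-- The partial derivative `∂g/∂x_i`. -/
noncomputable def partialDeriv {N : ℕ} (i : Fin N) (g : EuclideanSpace ℝ (Fin N) → ℝ)
    (x : EuclideanSpace ℝ (Fin N)) : ℝ :=
  fderiv ℝ g x (EuclideanSpace.single i 1)

/-- The operator `L v = div (A ∇v) - c v`. -/
noncomputable def ellipticOp {N : ℕ}
    (A : EuclideanSpace ℝ (Fin N) → Matrix (Fin N) (Fin N) ℝ)
    (c : EuclideanSpace ℝ (Fin N) → ℝ) (v : EuclideanSpace ℝ (Fin N) → ℝ)
    (x : EuclideanSpace ℝ (Fin N)) : ℝ :=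
  (∑ i, partialDeriv i (fun y => ∑ j, A y i j * partialDeriv j v y) x) - c x * v x

/-- `g`, defined on `(0, T] × Ω`, belongs to `C([0, T] × Ω̄)`: it has a continuous extension. -/
def IsContUpToBoundary {N : ℕ} (T : ℝ) (Ω : Set (EuclideanSpace ℝ (Fin N)))
    (g : ℝ → EuclideanSpace ℝ (Fin N) → ℝ) : Prop :=
  ∃ G : ℝ → EuclideanSpace ℝ (Fin N) → ℝ,
    ContinuousOn (Function.uncurry G) (Icc 0 T ×ˢ closure Ω) ∧
      ∀ t ∈ Ioc 0 T, ∀ x ∈ Ω, G t x = g t x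

/-- The class `C^{1,0}_{t,x}([0, T] × Ω̄)`: `u` and `u_t` are continuous on `[0, T] × Ω̄`. -/
structure MemC10 {N : ℕ} (T : ℝ) (Ω : Set (EuclideanSpace ℝ (Fin N)))
    (u : ℝ → EuclideanSpace ℝ (Fin N) → ℝ) : Prop where
  cont : ContinuousOn (Function.uncurry u) (Icc 0 T ×ˢ closure Ω)
  diff : ∀ x ∈ closure Ω, DifferentiableOn ℝ (fun t => u t x) (Icc 0 T)
  cont_timeDeriv : ContinuousOn (Function.uncurry (timeDeriv T u)) (Icc 0 T ×ˢ closure Ω)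

/-- The class `C^{α,2}_{t,x}([0, T] × Ω̄)`: `u` is in `C^{1,0}_{t,x}([0, T] × Ω̄)`, and `∂_t^α u`
and all second order space derivatives of `u` exist and are continuous up to the boundary. -/
structure MemCα2 {N : ℕ} (α T : ℝ) (Ω : Set (EuclideanSpace ℝ (Fin N)))
    (u : ℝ → EuclideanSpace ℝ (Fin N) → ℝ) : Prop extends MemC10 T Ω u where
  diff_caputo : ∀ x ∈ Ω, DifferentiableOn ℝ (caputoPrimitive α T u x) (Ioc 0 T)
  cont_caputo : IsContUpToBoundary T Ω (caputo α T u)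
  contDiff_space : ∀ t ∈ Ioc 0 T, ContDiffOn ℝ 2 (u t) Ω
  cont_space : ∀ i j, IsContUpToBoundary T Ω
    (fun t => partialDeriv i (partialDeriv j (u t)))

/-- The pair `{u, h}` is a solution of the inverse problem of recovering the space-dependent source
factor `h` from the time-averaged velocity `ω`. -/
structure IsSolutionIP2 {N : ℕ} (α T : ℝ) (Ω : Set (EuclideanSpace ℝ (Fin N)))
    (A : EuclideanSpace ℝ (Fin N) → Matrix (Fin N) (Fin N) ℝ)
    (c φ ψ : EuclideanSpace ℝ (Fin N) → ℝ) (f : ℝ → ℝ) (ω : EuclideanSpace ℝ (Fin N) → ℝ)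
    (u : ℝ → EuclideanSpace ℝ (Fin N) → ℝ) (h : EuclideanSpace ℝ (Fin N) → ℝ) : Prop where
  mem_u : MemCα2 α T Ω u
  mem_h : ContinuousOn h (closure Ω)
  equation : ∀ t ∈ Ioc 0 T, ∀ x ∈ Ω, caputo α T u t x - ellipticOp A c (u t) x = f t * h x
  initial : ∀ x ∈ closure Ω, u 0 x = φ x
  initial_velocity : ∀ x ∈ closure Ω, timeDeriv T u 0 x = ψ x
  boundary : ∀ t ∈ Icc 0 T, ∀ x ∈ frontier Ω, u t x = 0
  overdetermination : ∀ x ∈ closure Ω, ∫ t in (0 : ℝ)..T, f t * timeDeriv T u t x = ω x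

/-- Fubini's theorem on a triangle for a convolution with a weakly singular kernel. -/
theorem integral_abel_primitive {γ s : ℝ} (hγ : γ < 1) (hs : 0 ≤ s) {p : ℝ → ℝ}
    (hp : IntegrableOn p (Ioc 0 s)) :
    (∫ τ in (0 : ℝ)..s, (∫ r in (0 : ℝ)..τ, p r) / (s - τ) ^ γ) =
      ∫ ρ in (0 : ℝ)..s, ∫ τ in (0 : ℝ)..ρ, p τ / (ρ - τ) ^ γ := by
  set k : ℝ → ℝ := fun σ => (σ ^ γ)⁻¹ with hk
  set k' : ℝ → ℝ := (Ioc 0 s).indicator k with hk'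
  set p' : ℝ → ℝ := (Ioc 0 s).indicator p with hp'
  have hkint : Integrable k' := by
    rw [hk', integrable_indicator_iff measurableSet_Ioc]
    have h := intervalIntegral.intervalIntegrable_rpow' (a := 0) (b := s) (r := -γ) (by linarith)
    rw [intervalIntegrable_iff_integrableOn_Ioc_of_le hs] at h
    refine h.congr_fun (fun σ hσ => ?_) measurableSet_Ioc
    simp only [hk]
    rw [Real.rpow_neg hσ.1.le]
  have hpint : Integrable p' := by
    rwa [hp', integrable_indicator_iff measurableSet_Ioc]
  have hF : Integrable (fun q : ℝ × ℝ => k' q.2 * p' (q.1 - q.2)) (volume.prod volume) :=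
    hkint.convolution_integrand (ContinuousLinearMap.mul ℝ ℝ) hpint
  have hswap : (∫ ρ in Iic s, ∫ σ, k' σ * p' (ρ - σ)) = ∫ σ, ∫ ρ in Iic s, k' σ * p' (ρ - σ) := by
    refine integral_integral_swap (f := fun ρ σ => k' σ * p' (ρ - σ)) ?_
    have h := hF.restrict (s := Iic s ×ˢ univ)
    rwa [← Measure.prod_restrict, Measure.restrict_univ] at h
  -- inner integral, order `dσ dρ`
  have h1 : ∀ ρ ∈ Ioc 0 s, (∫ σ, k' σ * p' (ρ - σ)) = ∫ τ in (0 : ℝ)..ρ, p τ / (ρ - τ) ^ γ := by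
    intro ρ hρ
    have e : (fun σ => k' σ * p' (ρ - σ)) =
        (Ioo 0 ρ).indicator (fun σ => k σ * p (ρ - σ)) := by
      funext σ
      simp only [hk', hp', indicator, mem_Ioc, mem_Ioo]
      obtain ⟨_, _⟩ := hρ
      split_ifs <;> first | (exfalso; grind) | simp
    rw [e, integral_indicator measurableSet_Ioo, ← integral_Ioc_eq_integral_Ioo,
      ← intervalIntegral.integral_of_le hρ.1.le]
    have h := intervalIntegral.integral_comp_sub_left (a := 0) (b := ρ)
      (fun τ => p τ / (ρ - τ) ^ γ) ρ
    simp only [sub_self, sub_zero, sub_sub_cancel] at h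
    rw [← h]
    refine intervalIntegral.integral_congr fun σ _ => ?_
    simp only [hk]
    ring
  have h0 : ∀ ρ ∈ Iic s \ Ioc 0 s, (∫ σ, k' σ * p' (ρ - σ)) = 0 := by
    intro ρ hρ
    have e : (fun σ => k' σ * p' (ρ - σ)) = fun _ => 0 := by
      funext σ
      simp only [hk', hp', indicator, mem_Ioc]
      simp only [mem_sdiff, mem_Iic, mem_Ioc] at hρ
      split_ifs <;> first | (exfalso; grind) | simp
    rw [e, integral_zero]
  -- inner integral, order `dρ dσ`
  have h2 : ∀ σ, (∫ ρ in Iic s, k' σ * p' (ρ - σ)) =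
      (Ioc 0 s).indicator (fun σ => k σ * ∫ r in (0 : ℝ)..(s - σ), p r) σ := by
    intro σ
    rw [integral_const_mul]
    by_cases hσ : σ ∈ Ioc 0 s
    · have e : (∫ ρ in Iic s, p' (ρ - σ)) = ∫ r in (0 : ℝ)..(s - σ), p r := by
        rw [← integral_indicator measurableSet_Iic]
        have e1 : (Iic s).indicator (fun ρ => p' (ρ - σ)) =
            fun ρ => (Ioc 0 (s - σ)).indicator p (ρ - σ) := by
          funext ρ
          simp only [hp', indicator, mem_Ioc, mem_Iic]
          obtain ⟨_, _⟩ := hσ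
          split_ifs <;> first | (exfalso; grind) | rfl
        rw [e1, integral_sub_right_eq_self (fun r => (Ioc 0 (s - σ)).indicator p r) σ,
          integral_indicator measurableSet_Ioc,
          ← intervalIntegral.integral_of_le (sub_nonneg.2 hσ.2)]
      rw [e, indicator_of_mem hσ, hk', indicator_of_mem hσ]
    · rw [indicator_of_notMem hσ, hk', indicator_of_notMem hσ, zero_mul]
  have hL : (∫ ρ in Iic s, ∫ σ, k' σ * p' (ρ - σ)) =
      ∫ ρ in (0 : ℝ)..s, ∫ τ in (0 : ℝ)..ρ, p τ / (ρ - τ) ^ γ := by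
    rw [setIntegral_eq_of_subset_of_forall_sdiff_eq_zero measurableSet_Iic
      (fun ρ (hρ : ρ ∈ Ioc 0 s) => hρ.2) h0, intervalIntegral.integral_of_le hs]
    exact setIntegral_congr_fun measurableSet_Ioc h1
  have hR : (∫ σ, ∫ ρ in Iic s, k' σ * p' (ρ - σ)) =
      ∫ τ in (0 : ℝ)..s, (∫ r in (0 : ℝ)..τ, p r) / (s - τ) ^ γ := by
    simp_rw [h2]
    rw [integral_indicator measurableSet_Ioc, ← intervalIntegral.integral_of_le hs]
    have h := intervalIntegral.integral_comp_sub_left (a := 0) (b := s)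
      (fun τ => (∫ r in (0 : ℝ)..τ, p r) / (s - τ) ^ γ) s
    simp only [sub_self, sub_zero, sub_sub_cancel] at h
    rw [← h]
    refine intervalIntegral.integral_congr fun σ _ => ?_
    simp only [hk]
    ring
  rw [← hL, ← hR, hswap]

/-- If `u_t(·, x)` is absolutely continuous on `[0, T]` and `I_{0+}^{2-α} u_tt(·, x)` coincides on
`(0, T]` with a continuous function `w` on `[0, T]`, then `w` is the Caputo derivative. -/
theorem hasDerivWithinAt_caputoPrimitive {E : Type*} {α T : ℝ} (hα₂ : α < 2)
    (hT : 0 < T) (u : ℝ → E → ℝ) (x : E)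
    (hac : AbsolutelyContinuousOnInterval (fun s => timeDeriv T u s x) 0 T)
    (w : ℝ → ℝ) (hw : ContinuousOn w (Icc 0 T))
    (hwe : ∀ t ∈ Ioc 0 T,
      rlIntegral (2 - α) (fun τ => deriv (fun s => timeDeriv T u s x) τ) t = w t) :
    ∀ t ∈ Icc 0 T, HasDerivWithinAt (caputoPrimitive α T u x) (w t) (Icc 0 T) t := by
  set v : ℝ → ℝ := fun s => timeDeriv T u s x with hv
  have hpi : IntegrableOn (deriv v) (Ioc 0 T) := by
    have h := hac.intervalIntegrable_deriv
    rwa [intervalIntegrable_iff_integrableOn_Ioc_of_le hT.le] at h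
  have key : ∀ s ∈ Icc 0 T, caputoPrimitive α T u x s = ∫ t in (0 : ℝ)..s, w t := by
    intro s hs
    have hps : IntegrableOn (deriv v) (Ioc 0 s) := hpi.mono_set (Ioc_subset_Ioc_right hs.2)
    have h1 : caputoPrimitive α T u x s =
        (Real.Gamma (2 - α))⁻¹ *
          ∫ τ in (0 : ℝ)..s, (∫ r in (0 : ℝ)..τ, deriv v r) / (s - τ) ^ (1 - (2 - α)) := by
      unfold caputoPrimitive rlIntegral
      congr 1
      refine intervalIntegral.integral_congr fun τ hτ => ?_
      rw [uIcc_of_le hs.1] at hτ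
      have hsub : uIcc 0 τ ⊆ uIcc 0 T := by
        rw [uIcc_of_le hτ.1, uIcc_of_le hT.le]
        exact Icc_subset_Icc_right (hτ.2.trans hs.2)
      have h := (hac.mono hsub).integral_deriv_eq_sub
      change (v τ - v 0) / _ = _
      rw [← h]
    rw [h1, integral_abel_primitive (by linarith) hs.1 hps, ← intervalIntegral.integral_const_mul,
      intervalIntegral.integral_of_le hs.1, intervalIntegral.integral_of_le hs.1]
    refine setIntegral_congr_fun measurableSet_Ioc fun ρ hρ => ?_
    exact hwe ρ ⟨hρ.1, hρ.2.trans hs.2⟩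
  intro t ht
  have hi : IntervalIntegrable w volume 0 t := by
    apply ContinuousOn.intervalIntegrable
    rw [uIcc_of_le ht.1]
    exact hw.mono (Icc_subset_Icc_right ht.2)
  have : Fact (t ∈ Icc 0 T) := ⟨ht⟩
  have h : HasDerivWithinAt (fun s => ∫ r in (0 : ℝ)..s, w r) (w t) (Icc 0 T) t :=
    intervalIntegral.integral_hasDerivWithinAt_right hi
      (hw.stronglyMeasurableAtFilter_nhdsWithin measurableSet_Icc t) (hw t ht)
  exact h.congr key (key t ht)

end FracWave

/-! Subtract two solutions: `u`, `h` now have zero data, `v = u_t` has zero initial value, and with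
`G` the continuous extension of the Caputo derivative the equation reads `Lu = G - f h`. Multiply by
`v` and integrate over the cylinder. The source term contributes `∫ h (∫ f v dt) dx`, which is zero
because both solutions have the same `ω`. What remains is `∫∫ Lu · u_t = ∫∫ G v`, and the two sides
have opposite signs.

The left side is half of `∫ Lu(T) u(T) dx ≤ 0`, since `L` is symmetric and nonpositive under zero
boundary values and `u(0) = 0` (`integral_integral_mul_nonpos`). The boundary of `Ω` is arbitrary
and nothing is known about `∇u` near it, so Green's identity is proved by testing with truncations
of `u` that vanish near the boundary, then removing the truncation (`green_truncated`,
`integral_divFlux_mul`).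

The right side is nonnegative for each fixed `x` (`integral_mul_nonneg_of_abel_primitive`).
Inverting the Abel integral expresses `v` as a positive multiple of the Abel integral of `G`,
without a second time derivative. The kernel `t ^ (-γ)` is a positive superposition of exponentials
`e^(-s t)`, and for a single exponential the quadratic form is `y(T)² / 2 + s ∫ y²`, where `y' + s y
= g` and `y(0) = 0` (`integral_mul_expConv`). Equality forces `g = 0`.

Hence both sides vanish, so `G = v = 0` and `u = 0`. The equation then reduces to `f h = 0`, and a
time with `f ≠ 0` gives `h = 0`. -/

namespace FracWave

/-! ### Abel kernels of complementary orders -/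

/-- The kernel `x ↦ x ^ (-γ)` on the positive half line, extended by zero. -/
noncomputable def abelKernel (γ x : ℝ) : ℝ := (Ioi 0).indicator (fun x => (x ^ γ)⁻¹) x

theorem abelKernel_of_pos (γ : ℝ) {x : ℝ} (hx : 0 < x) : abelKernel γ x = (x ^ γ)⁻¹ :=
  indicator_of_mem (show x ∈ Ioi 0 from hx) _

theorem abelKernel_of_nonpos (γ : ℝ) {x : ℝ} (hx : x ≤ 0) : abelKernel γ x = 0 :=
  indicator_of_notMem (by simpa using hx) _

theorem abelKernel_nonneg (γ x : ℝ) : 0 ≤ abelKernel γ x :=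
  indicator_nonneg (fun _ hx => inv_nonneg.2 (Real.rpow_nonneg (le_of_lt hx) _)) x

theorem measurable_abelKernel (γ : ℝ) : Measurable (abelKernel γ) :=
  Measurable.indicator (by fun_prop) measurableSet_Ioi

theorem abelKernel_mul (γ : ℝ) {a : ℝ} (ha : 0 < a) (x : ℝ) :
    abelKernel γ (a * x) = (a ^ γ)⁻¹ * abelKernel γ x := by
  rcases lt_or_ge 0 x with hx | hx
  · rw [abelKernel_of_pos γ hx, abelKernel_of_pos γ (mul_pos ha hx),
      Real.mul_rpow ha.le hx.le, mul_inv]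
  · rw [abelKernel_of_nonpos γ hx, abelKernel_of_nonpos γ (mul_nonpos_of_nonneg_of_nonpos ha.le hx),
      mul_zero]

/-- On `(0, 1)` this is the norm of the Beta integrand with parameters `1 - β` and `β`, both
positive. -/
theorem integrable_abelKernel_mul_one_sub {β : ℝ} (hβ₀ : 0 < β) (hβ₁ : β < 1) :
    Integrable (fun x => abelKernel β x * abelKernel (1 - β) (1 - x)) := by
  have h := (Complex.betaIntegral_convergent (u := ((1 - β : ℝ) : ℂ)) (v := ((β : ℝ) : ℂ))
    (by simpa using hβ₁) (by simpa using hβ₀)).norm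
  rw [intervalIntegrable_iff_integrableOn_Ioo_of_le zero_le_one,
    ← integrable_indicator_iff measurableSet_Ioo] at h
  refine h.congr (Filter.Eventually.of_forall fun x => ?_)
  by_cases hx : x ∈ Ioo (0 : ℝ) 1
  · have h1 : 0 < 1 - x := by linarith [hx.2]
    simp only [indicator_of_mem hx]
    rw [abelKernel_of_pos _ hx.1, abelKernel_of_pos _ h1, norm_mul,
      Complex.norm_cpow_eq_rpow_re_of_pos hx.1,
      show (1 : ℂ) - (x : ℂ) = ((1 - x : ℝ) : ℂ) by push_cast; rfl,
      Complex.norm_cpow_eq_rpow_re_of_pos h1, ← Real.rpow_neg hx.1.le, ← Real.rpow_neg h1.le]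
    congr 2 <;> simp
  · simp only [indicator_of_notMem hx]
    rcases le_or_gt x 0 with h0 | h0
    · rw [abelKernel_of_nonpos _ h0, zero_mul]
    · rw [abelKernel_of_nonpos (1 - β) (x := 1 - x), mul_zero]
      by_contra h1
      exact hx ⟨h0, by linarith⟩

/-- The convolution of the kernels of orders `β` and `1 - β` on the positive half line. -/
noncomputable def abelConst (β : ℝ) : ℝ := ∫ x, abelKernel β x * abelKernel (1 - β) (1 - x)

/-- The integrand is positive on all of `(0, 1)`. Only the sign of the constant matters later, not
its Gamma function value. -/
theorem abelConst_pos {β : ℝ} (hβ₀ : 0 < β) (hβ₁ : β < 1) : 0 < abelConst β := by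
  refine (integral_pos_iff_support_of_nonneg
    (fun x => mul_nonneg (abelKernel_nonneg _ _) (abelKernel_nonneg _ _))
    (integrable_abelKernel_mul_one_sub hβ₀ hβ₁)).2 ?_
  refine lt_of_lt_of_le ?_ (measure_mono (s := Ioo (0 : ℝ) 1) fun x hx => ?_)
  · simp
  · have h1 : 0 < 1 - x := by linarith [hx.2]
    simp only [Function.mem_support]
    rw [abelKernel_of_pos _ hx.1, abelKernel_of_pos _ h1]
    have := Real.rpow_pos_of_pos hx.1 β
    have := Real.rpow_pos_of_pos h1 (1 - β)
    positivity

/-- The exponents add up to one, so the product is homogeneous of degree `-1`. This cancels the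
Jacobian of the substitution, and the convolution of the two kernels is constant on the positive
half line. -/
theorem abelKernel_convolution_scale {β a : ℝ} (ha : 0 < a) (x : ℝ) :
    abelKernel β (a * x) * abelKernel (1 - β) (a - a * x) =
      a⁻¹ * (abelKernel β x * abelKernel (1 - β) (1 - x)) := by
  rw [show a - a * x = a * (1 - x) by ring, abelKernel_mul _ ha, abelKernel_mul _ ha]
  have h : (a ^ β)⁻¹ * (a ^ (1 - β))⁻¹ = a⁻¹ := by
    rw [← mul_inv, ← Real.rpow_add ha]
    simp
  rw [← h]
  ring

theorem abelKernel_convolution_of_nonpos {β a : ℝ} (ha : a ≤ 0) (x : ℝ) :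
    abelKernel β x * abelKernel (1 - β) (a - x) = 0 := by
  rcases le_or_gt x 0 with h0 | h0
  · rw [abelKernel_of_nonpos _ h0, zero_mul]
  · rw [abelKernel_of_nonpos (1 - β) (x := a - x) (by linarith), mul_zero]

theorem integrable_abelKernel_convolution {β : ℝ} (hβ₀ : 0 < β) (hβ₁ : β < 1) (a : ℝ) :
    Integrable (fun x => abelKernel β x * abelKernel (1 - β) (a - x)) := by
  rcases le_or_gt a 0 with ha | ha
  · simp_rw [abelKernel_convolution_of_nonpos ha]
    exact integrable_zero _ _ _
  · rw [← integrable_comp_mul_left_iff _ ha.ne']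
    simp_rw [abelKernel_convolution_scale ha]
    exact (integrable_abelKernel_mul_one_sub hβ₀ hβ₁).const_mul _

theorem integral_abelKernel_convolution {β a : ℝ} (ha : 0 < a) :
    ∫ x, abelKernel β x * abelKernel (1 - β) (a - x) = abelConst β := by
  have h := Measure.integral_comp_mul_left
    (fun x => abelKernel β x * abelKernel (1 - β) (a - x)) a
  simp_rw [abelKernel_convolution_scale ha] at h
  rw [integral_const_mul, abs_of_pos (inv_pos.2 ha), smul_eq_mul] at h
  exact (mul_left_cancel₀ (inv_pos.2 ha).ne' h).symm

/-- Fractional integrals of complementary orders compose to the ordinary integral, up to a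
constant. -/
theorem abel_inversion {β t : ℝ} (hβ₀ : 0 < β) (hβ₁ : β < 1) (ht : 0 ≤ t) {v : ℝ → ℝ}
    (hv : Continuous v) :
    ∫ τ in (0 : ℝ)..t, (∫ r in (0 : ℝ)..τ, v r / (τ - r) ^ β) / (t - τ) ^ (1 - β) =
      abelConst β * ∫ r in (0 : ℝ)..t, v r := by
  -- Extending `v` and both kernels by zero turns the triangle `0 < r < τ < t` into the whole plane.
  -- After the exchange of integrals, the inner one in `τ` is a translated kernel convolution, equal
  -- to `abelConst β` for every `r` in `(0, t)`.
  set v' : ℝ → ℝ := (Ioo 0 t).indicator v with hv'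
  have hv'm : Measurable v' := hv.measurable.indicator measurableSet_Ioo
  have hv'i : Integrable v' := by
    rw [hv', integrable_indicator_iff measurableSet_Ioo]
    exact hv.integrableOn_Icc.mono_set Ioo_subset_Icc_self
  have hshift : ∀ r, (fun τ => abelKernel β (τ - r) * abelKernel (1 - β) (t - τ)) =
      fun τ => (fun x => abelKernel β x * abelKernel (1 - β) (t - r - x)) (τ - r) := by
    intro r
    funext τ
    simp only
    congr 2
    ring
  have hki : ∀ r, Integrable (fun τ => abelKernel β (τ - r) * abelKernel (1 - β) (t - τ)) := by
    intro r
    rw [hshift]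
    exact (integrable_abelKernel_convolution hβ₀ hβ₁ (t - r)).comp_sub_right r
  have hkv : ∀ r ∈ Ioo 0 t, ∫ τ, abelKernel β (τ - r) * abelKernel (1 - β) (t - τ) =
      abelConst β := by
    intro r hr
    rw [hshift, integral_sub_right_eq_self
      (fun x => abelKernel β x * abelKernel (1 - β) (t - r - x)) r,
      integral_abelKernel_convolution (sub_pos.2 hr.2)]
  have hFm : Measurable (fun p : ℝ × ℝ =>
      v' p.1 * (abelKernel β (p.2 - p.1) * abelKernel (1 - β) (t - p.2))) :=
    (hv'm.comp measurable_fst).mul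
      (((measurable_abelKernel β).comp (measurable_snd.sub measurable_fst)).mul
        ((measurable_abelKernel (1 - β)).comp (measurable_const.sub measurable_snd)))
  have hF : Integrable (fun p : ℝ × ℝ =>
      v' p.1 * (abelKernel β (p.2 - p.1) * abelKernel (1 - β) (t - p.2)))
      (volume.prod volume) := by
    refine (integrable_prod_iff hFm.aestronglyMeasurable).2
      ⟨Filter.Eventually.of_forall fun r => (hki r).const_mul (v' r), ?_⟩
    refine (hv'i.norm.mul_const (abelConst β)).congr (Filter.Eventually.of_forall fun r => ?_)
    simp only [norm_mul, Real.norm_of_nonneg (abelKernel_nonneg _ _)]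
    rw [integral_const_mul]
    by_cases hr : r ∈ Ioo 0 t
    · rw [hkv r hr]
    · simp [hv', indicator_of_notMem hr]
  have hswap := integral_integral_swap
    (f := fun r τ => v' r * (abelKernel β (τ - r) * abelKernel (1 - β) (t - τ))) hF
  have hL : (∫ r, ∫ τ, v' r * (abelKernel β (τ - r) * abelKernel (1 - β) (t - τ))) =
      abelConst β * ∫ r in (0 : ℝ)..t, v r := by
    rw [intervalIntegral.integral_of_le ht, integral_Ioc_eq_integral_Ioo,
      ← integral_indicator measurableSet_Ioo, ← integral_const_mul]
    refine integral_congr_ae (Filter.Eventually.of_forall fun r => ?_)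
    simp only [integral_const_mul]
    by_cases hr : r ∈ Ioo 0 t
    · rw [hkv r hr, mul_comm]
    · simp [hv', indicator_of_notMem hr]
  have hin : ∀ τ ∈ Ioo 0 t, (∫ r, v' r * abelKernel β (τ - r)) =
      ∫ r in (0 : ℝ)..τ, v r / (τ - r) ^ β := by
    intro τ hτ
    rw [intervalIntegral.integral_of_le hτ.1.le, integral_Ioc_eq_integral_Ioo,
      ← integral_indicator measurableSet_Ioo]
    refine integral_congr_ae (Filter.Eventually.of_forall fun r => ?_)
    by_cases hr : r ∈ Ioo 0 τ
    · simp only [indicator_of_mem hr]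
      rw [hv', indicator_of_mem (show r ∈ Ioo 0 t from ⟨hr.1, hr.2.trans hτ.2⟩),
        abelKernel_of_pos _ (sub_pos.2 hr.2),
        div_eq_mul_inv]
    · simp only [indicator_of_notMem hr]
      rcases le_or_gt τ r with h | h
      · rw [abelKernel_of_nonpos _ (by linarith), mul_zero]
      · rw [hv', indicator_of_notMem (fun hh => hr ⟨hh.1, h⟩), zero_mul]
  have hR : (∫ τ, ∫ r, v' r * (abelKernel β (τ - r) * abelKernel (1 - β) (t - τ))) =
      ∫ τ in (0 : ℝ)..t, (∫ r in (0 : ℝ)..τ, v r / (τ - r) ^ β) / (t - τ) ^ (1 - β) := by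
    rw [intervalIntegral.integral_of_le ht, integral_Ioc_eq_integral_Ioo,
      ← integral_indicator measurableSet_Ioo]
    refine integral_congr_ae (Filter.Eventually.of_forall fun τ => ?_)
    simp only [← mul_assoc, integral_mul_const]
    by_cases hτ : τ ∈ Ioo 0 t
    · rw [indicator_of_mem hτ, hin τ hτ, abelKernel_of_pos _ (sub_pos.2 hτ.2), div_eq_mul_inv]
    · rw [indicator_of_notMem hτ]
      rcases le_or_gt t τ with h | h
      · rw [abelKernel_of_nonpos (1 - β) (by linarith), mul_zero]
      · have hz : ∀ r, v' r * abelKernel β (τ - r) = 0 := by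
          intro r
          rcases le_or_gt r 0 with h0 | h0
          · rw [hv', indicator_of_notMem (fun hh => absurd hh.1 (not_lt.2 h0)), zero_mul]
          · have : τ ≤ 0 := not_lt.1 fun hh => hτ ⟨hh, h⟩
            rw [abelKernel_of_nonpos _ (by linarith), mul_zero]
        simp [hz]
  rw [← hR, ← hswap, hL]

/-! ### Exponential convolutions and positivity of the Abel quadratic form -/

/-- The solution of `y' + s y = g`, `y 0 = 0`. -/
noncomputable def expConv (g : ℝ → ℝ) (s t : ℝ) : ℝ :=
  ∫ τ in (0 : ℝ)..t, Real.exp (-(s * (t - τ))) * g τ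

theorem continuous_expConv {g : ℝ → ℝ} (hg : Continuous g) :
    Continuous (fun p : ℝ × ℝ => expConv g p.1 p.2) := by
  refine intervalIntegral.continuous_parametric_intervalIntegral_of_continuous
    (f := fun (p : ℝ × ℝ) τ => Real.exp (-(p.1 * (p.2 - τ))) * g τ) ?_ continuous_snd
  exact ((Real.continuous_exp.comp (by fun_prop)).mul (hg.comp continuous_snd))

/-- Pulling `e^(-s t)` out of the integral leaves `t` only in the upper limit, so the product rule
applies. -/
theorem hasDerivAt_expConv {g : ℝ → ℝ} (hg : Continuous g) (s t : ℝ) :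
    HasDerivAt (expConv g s) (g t - s * expConv g s t) t := by
  have e : ∀ t, expConv g s t =
      Real.exp (-(s * t)) * ∫ τ in (0 : ℝ)..t, Real.exp (s * τ) * g τ := by
    intro t
    rw [expConv, ← intervalIntegral.integral_const_mul]
    refine intervalIntegral.integral_congr fun τ _ => ?_
    rw [← mul_assoc, ← Real.exp_add]
    ring_nf
  have h1 : HasDerivAt (fun t => ∫ τ in (0 : ℝ)..t, Real.exp (s * τ) * g τ)
      (Real.exp (s * t) * g t) t := by
    have hc : Continuous fun τ => Real.exp (s * τ) * g τ := by fun_prop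
    exact intervalIntegral.integral_hasDerivAt_right (hc.intervalIntegrable _ _)
      (hc.stronglyMeasurableAtFilter _ _) hc.continuousAt
  have h2 : HasDerivAt (fun t => Real.exp (-(s * t))) (Real.exp (-(s * t)) * -(s * 1)) t :=
    (((hasDerivAt_id t).const_mul s).neg).exp
  have h3 := h2.mul h1
  have e' : expConv g s = (fun t => Real.exp (-(s * t))) *
      fun t => ∫ τ in (0 : ℝ)..t, Real.exp (s * τ) * g τ := funext e
  rw [e']
  refine h3.congr_deriv ?_
  simp only [Pi.mul_apply]
  have h4 : Real.exp (-(s * t)) * Real.exp (s * t) = 1 := by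
    rw [← Real.exp_add]; simp
  linear_combination (g t) * h4

/-- Both bounds are needed: the one by `T` controls `s` near zero, the one by `s⁻¹` controls large
`s`. -/
theorem integral_exp_neg_mul_sub_le {s t T : ℝ} (hs : 0 < s) (ht : t ∈ Icc 0 T) :
    ∫ τ in (0 : ℝ)..t, Real.exp (-(s * (t - τ))) ≤ min T s⁻¹ := by
  have hc : Continuous fun τ => Real.exp (-(s * (t - τ))) := by fun_prop
  refine le_min ?_ ?_
  · calc ∫ τ in (0 : ℝ)..t, Real.exp (-(s * (t - τ))) ≤ ∫ τ in (0 : ℝ)..t, (1 : ℝ) := by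
          refine intervalIntegral.integral_mono_on ht.1 (hc.intervalIntegrable _ _)
            (by simp) fun τ hτ => ?_
          rw [Real.exp_le_one_iff]
          have := mul_nonneg hs.le (sub_nonneg.2 hτ.2)
          linarith
      _ ≤ T := by simpa using ht.2
  · have hd : ∀ τ, HasDerivAt (fun τ => s⁻¹ * Real.exp (-(s * (t - τ))))
        (Real.exp (-(s * (t - τ)))) τ := by
      intro τ
      have h := (((((hasDerivAt_id τ).const_sub t).const_mul s).neg).exp).const_mul s⁻¹
      refine h.congr_deriv ?_
      simp only [id, Pi.neg_apply]
      field_simp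
    rw [intervalIntegral.integral_eq_sub_of_hasDerivAt (fun τ _ => hd τ)
      (hc.intervalIntegrable _ _)]
    simp only [sub_self, mul_zero, neg_zero, Real.exp_zero, mul_one]
    have : 0 < s⁻¹ * Real.exp (-(s * (t - 0))) := by positivity
    linarith

/-- Near zero the exponent is `γ - 1 > -1`, at infinity it is `γ - 2 < -1`. This function dominates
every integral over the exponential rate `s` below. -/
theorem integrableOn_rpow_mul_min {γ T : ℝ} (hγ₀ : 0 < γ) (hγ₁ : γ < 1) (hT : 0 ≤ T) :
    IntegrableOn (fun s => s ^ (γ - 1) * min T s⁻¹) (Ioi 0) := by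
  have hm : ∀ S : Set ℝ, AEStronglyMeasurable (fun s : ℝ => s ^ (γ - 1) * min T s⁻¹)
      (volume.restrict S) := fun S => Measurable.aestronglyMeasurable (by fun_prop)
  rw [← Ioc_union_Ioi_eq_Ioi zero_le_one]
  refine IntegrableOn.union ?_ ?_
  · have h := intervalIntegral.intervalIntegrable_rpow' (a := 0) (b := 1) (r := γ - 1) (by linarith)
    rw [intervalIntegrable_iff_integrableOn_Ioc_of_le zero_le_one] at h
    refine (h.mul_const T).mono' (hm _) ?_
    refine (ae_restrict_iff' measurableSet_Ioc).2 (Filter.Eventually.of_forall fun s hs => ?_)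
    have h1 := Real.rpow_nonneg hs.1.le (γ - 1)
    have h2 : 0 ≤ min T s⁻¹ := le_min hT (inv_nonneg.2 hs.1.le)
    rw [Real.norm_of_nonneg (mul_nonneg h1 h2)]
    exact mul_le_mul_of_nonneg_left (min_le_left _ _) h1
  · refine (integrableOn_Ioi_rpow_of_lt (a := γ - 2) (by linarith) zero_lt_one).mono' (hm _) ?_
    refine (ae_restrict_iff' measurableSet_Ioi).2 (Filter.Eventually.of_forall fun s hs => ?_)
    have hs0 : (0 : ℝ) < s := zero_lt_one.trans hs
    have h1 := Real.rpow_nonneg hs0.le (γ - 1)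
    have h2 : 0 ≤ min T s⁻¹ := le_min hT (inv_nonneg.2 hs0.le)
    rw [Real.norm_of_nonneg (mul_nonneg h1 h2), show γ - 2 = γ - 1 - 1 by ring,
      Real.rpow_sub_one hs0.ne' (γ - 1), div_eq_mul_inv]
    exact mul_le_mul_of_nonneg_left (min_le_right _ _) h1

theorem abs_expConv_le {g : ℝ → ℝ} (hg : Continuous g) {M T : ℝ}
    (hM : ∀ t ∈ Icc 0 T, |g t| ≤ M) {s t : ℝ} (hs : 0 < s) (ht : t ∈ Icc 0 T) :
    |expConv g s t| ≤ M * min T s⁻¹ := by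
  have hM0 : 0 ≤ M := (abs_nonneg _).trans (hM t ht)
  have hc : Continuous fun τ => Real.exp (-(s * (t - τ))) := by fun_prop
  refine le_trans ?_ (mul_le_mul_of_nonneg_left (integral_exp_neg_mul_sub_le hs ht) hM0)
  rw [← intervalIntegral.integral_const_mul]
  refine (intervalIntegral.abs_integral_le_integral_abs ht.1).trans ?_
  refine intervalIntegral.integral_mono_on ht.1 ((hc.mul hg).abs.intervalIntegrable _ _)
    ((continuous_const.mul hc).intervalIntegrable _ _) fun τ hτ => ?_
  rw [abs_mul, Real.abs_exp, mul_comm]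
  exact mul_le_mul_of_nonneg_right (hM τ ⟨hτ.1, hτ.2.trans ht.2⟩) (Real.exp_pos _).le

theorem exists_abs_le_of_continuous {g : ℝ → ℝ} (hg : Continuous g) (T : ℝ) :
    ∃ M, 0 ≤ M ∧ ∀ t ∈ Icc 0 T, |g t| ≤ M := by
  obtain ⟨M, hM⟩ := isCompact_Icc.exists_bound_of_continuousOn (hg.continuousOn (s := Icc 0 T))
  exact ⟨max M 0, le_max_right _ _, fun t ht => (hM t ht).trans (le_max_left _ _)⟩

/-- The Abel integral as a superposition of exponential convolutions. -/
theorem abel_eq_integral_expConv {γ t : ℝ} (hγ₀ : 0 < γ) (hγ₁ : γ < 1) (ht : 0 ≤ t) {g : ℝ → ℝ}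
    (hg : Continuous g) :
    ∫ τ in (0 : ℝ)..t, g τ / (t - τ) ^ γ =
      (Real.Gamma γ)⁻¹ * ∫ s in Ioi (0 : ℝ), s ^ (γ - 1) * expConv g s t := by
  obtain ⟨M, hM0, hM⟩ := exists_abs_le_of_continuous hg t
  set F : ℝ → ℝ → ℝ := fun s τ => s ^ (γ - 1) * (Real.exp (-(s * (t - τ))) * g τ) with hFdef
  have hFm : Measurable (Function.uncurry F) := by
    have := hg.measurable
    simp only [hFdef, Function.uncurry_def]
    fun_prop
  have hF : Integrable (Function.uncurry F)
      ((volume.restrict (Ioi 0)).prod (volume.restrict (Ioc 0 t))) := by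
    refine (integrable_prod_iff hFm.aestronglyMeasurable).2
      ⟨Filter.Eventually.of_forall fun s => ?_, ?_⟩
    · have hc : Continuous fun τ => s ^ (γ - 1) * (Real.exp (-(s * (t - τ))) * g τ) := by fun_prop
      exact hc.integrableOn_Ioc
    · refine ((integrableOn_rpow_mul_min hγ₀ hγ₁ ht).const_mul M).mono'
        (hFm.aestronglyMeasurable.norm.integral_prod_right') ?_
      refine (ae_restrict_iff' measurableSet_Ioi).2 (Filter.Eventually.of_forall fun s hs => ?_)
      have hs0 : (0 : ℝ) < s := hs
      have h1 := Real.rpow_nonneg hs0.le (γ - 1)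
      rw [Real.norm_of_nonneg (integral_nonneg fun _ => norm_nonneg _)]
      simp only [Function.uncurry, hFdef, norm_mul, Real.norm_of_nonneg h1]
      rw [integral_const_mul, mul_left_comm]
      refine mul_le_mul_of_nonneg_left ?_ h1
      refine le_trans ?_ (mul_le_mul_of_nonneg_left
        (integral_exp_neg_mul_sub_le hs0 (right_mem_Icc.2 ht)) hM0)
      rw [← intervalIntegral.integral_of_le ht, ← intervalIntegral.integral_const_mul]
      have hc : Continuous fun τ => Real.exp (-(s * (t - τ))) := by fun_prop
      refine intervalIntegral.integral_mono_on ht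
        ((hc.norm.mul hg.norm).intervalIntegrable _ _)
        ((continuous_const.mul hc).intervalIntegrable _ _) fun τ hτ => ?_
      rw [Real.norm_of_nonneg (Real.exp_pos _).le, mul_comm]
      exact mul_le_mul_of_nonneg_right (hM τ hτ) (Real.exp_pos _).le
  have hswap := integral_integral_swap hF
  have hΓ := Real.Gamma_pos_of_pos hγ₀
  rw [eq_inv_mul_iff_mul_eq₀ hΓ.ne', intervalIntegral.integral_of_le ht,
    integral_Ioc_eq_integral_Ioo, ← integral_const_mul]
  have hL : ∀ s, s ^ (γ - 1) * expConv g s t = ∫ τ in Ioc 0 t, F s τ := by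
    intro s
    rw [expConv, ← intervalIntegral.integral_const_mul, intervalIntegral.integral_of_le ht]
  simp_rw [hL]
  rw [hswap, integral_Ioc_eq_integral_Ioo]
  -- For `p = t - τ > 0` the Gamma integral gives `∫ s^(γ-1) e^(-p s) ds = Γ(γ) p^(-γ)`. The open
  -- interval excludes `τ = t`, where `p = 0`.
  refine setIntegral_congr_fun measurableSet_Ioo fun τ hτ => ?_
  have hp := sub_pos.2 hτ.2
  have h := Real.integral_rpow_mul_exp_neg_mul_Ioi hγ₀ hp
  simp only [hFdef]
  simp_rw [← mul_assoc]
  rw [integral_mul_const]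
  have e : ∀ s : ℝ, -(s * (t - τ)) = -((t - τ) * s) := fun s => by ring
  simp_rw [e]
  rw [h, one_div, Real.inv_rpow hp.le]
  ring

theorem aestronglyMeasurable_rpow_mul_expConv {g : ℝ → ℝ} (hg : Continuous g) (γ t : ℝ) :
    AEStronglyMeasurable (fun s => s ^ (γ - 1) * expConv g s t) (volume.restrict (Ioi 0)) := by
  have hc : Continuous fun s => expConv g s t :=
    (continuous_expConv hg).comp (by fun_prop : Continuous fun s : ℝ => (s, t))
  have := hc.measurable
  exact Measurable.aestronglyMeasurable (by fun_prop)

theorem norm_rpow_mul_expConv_le {g : ℝ → ℝ} (hg : Continuous g) {M T : ℝ}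
    (hM : ∀ t ∈ Icc 0 T, |g t| ≤ M) (γ : ℝ) {s t : ℝ} (hs : 0 < s) (ht : t ∈ Icc 0 T) :
    ‖s ^ (γ - 1) * expConv g s t‖ ≤ M * (s ^ (γ - 1) * min T s⁻¹) := by
  have h1 := Real.rpow_nonneg hs.le (γ - 1)
  rw [norm_mul, Real.norm_of_nonneg h1, mul_left_comm]
  exact mul_le_mul_of_nonneg_left (abs_expConv_le hg hM hs ht) h1

/-- The singularity of the kernel moves with `t`. In the exponential representation the integrand is
continuous in `t` with a bound independent of `t`, so dominated convergence applies. -/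
theorem continuousOn_abel {γ T : ℝ} (hγ₀ : 0 < γ) (hγ₁ : γ < 1) (hT : 0 ≤ T) {g : ℝ → ℝ}
    (hg : Continuous g) :
    ContinuousOn (fun t => ∫ τ in (0 : ℝ)..t, g τ / (t - τ) ^ γ) (Icc 0 T) := by
  obtain ⟨M, hM0, hM⟩ := exists_abs_le_of_continuous hg T
  have h : ContinuousOn (fun t => ∫ s in Ioi (0 : ℝ), s ^ (γ - 1) * expConv g s t) (Icc 0 T) := by
    refine continuousOn_of_dominated (bound := fun s => M * (s ^ (γ - 1) * min T s⁻¹))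
      (fun t _ => aestronglyMeasurable_rpow_mul_expConv hg γ t) (fun t ht => ?_)
      ((integrableOn_rpow_mul_min hγ₀ hγ₁ hT).const_mul M) (Filter.Eventually.of_forall fun s => ?_)
    · exact (ae_restrict_iff' measurableSet_Ioi).2
        (Filter.Eventually.of_forall fun s hs => norm_rpow_mul_expConv_le hg hM γ hs ht)
    · have hc : Continuous fun t => expConv g s t :=
        (continuous_expConv hg).comp (by fun_prop : Continuous fun t : ℝ => (s, t))
      exact (continuous_const.mul hc).continuousOn
  exact (h.const_mul _).congr fun t ht => abel_eq_integral_expConv hγ₀ hγ₁ ht.1 hg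

/-- With `y = expConv g s`, the equation `y' = g - s y` gives `g y = (y² / 2)' + s y²`, and `y(0) =
0`. -/
theorem integral_mul_expConv {g : ℝ → ℝ} (hg : Continuous g) (s T : ℝ) :
    ∫ t in (0 : ℝ)..T, g t * expConv g s t =
      expConv g s T ^ 2 / 2 + s * ∫ t in (0 : ℝ)..T, expConv g s t ^ 2 := by
  have hc : Continuous fun t => expConv g s t :=
    (continuous_expConv hg).comp (by fun_prop : Continuous fun t : ℝ => (s, t))
  have hd : ∀ t, HasDerivAt (fun t => expConv g s t ^ 2 / 2)
      (g t * expConv g s t - s * expConv g s t ^ 2) t := by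
    intro t
    refine (((hasDerivAt_expConv hg s t).pow 2).div_const 2).congr_deriv ?_
    simp only [Nat.cast_ofNat]
    ring
  have h := intervalIntegral.integral_eq_sub_of_hasDerivAt (a := 0) (b := T) (fun t _ => hd t)
    (Continuous.intervalIntegrable (by fun_prop) _ _)
  rw [intervalIntegral.integral_sub (Continuous.intervalIntegrable (by fun_prop) _ _)
    (Continuous.intervalIntegrable (by fun_prop) _ _), intervalIntegral.integral_const_mul] at h
  have h0 : expConv g s 0 = 0 := by simp [expConv]
  rw [h0] at h
  linarith

/-- The quadratic form of the Abel kernel as an integral of squares. -/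
theorem integral_mul_abel {γ T : ℝ} (hγ₀ : 0 < γ) (hγ₁ : γ < 1) (hT : 0 ≤ T) {g : ℝ → ℝ}
    (hg : Continuous g) :
    IntegrableOn (fun s => s ^ (γ - 1) * ∫ t in (0 : ℝ)..T, g t * expConv g s t) (Ioi 0) ∧
    ∫ t in (0 : ℝ)..T, g t * ∫ τ in (0 : ℝ)..t, g τ / (t - τ) ^ γ =
      (Real.Gamma γ)⁻¹ * ∫ s in Ioi (0 : ℝ), s ^ (γ - 1) *
        ∫ t in (0 : ℝ)..T, g t * expConv g s t := by
  obtain ⟨M, hM0, hM⟩ := exists_abs_le_of_continuous hg T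
  set F : ℝ → ℝ → ℝ := fun t s => g t * (s ^ (γ - 1) * expConv g s t) with hFdef
  have hFm : Measurable (Function.uncurry F) := by
    have h1 := hg.measurable
    have h2 : Measurable fun p : ℝ × ℝ => expConv g p.2 p.1 :=
      ((continuous_expConv hg).comp continuous_swap).measurable
    simp only [hFdef, Function.uncurry_def]
    fun_prop
  have hb : ∀ t ∈ Icc 0 T, ∀ s ∈ Ioi (0 : ℝ), ‖F t s‖ ≤ M * (M * (s ^ (γ - 1) * min T s⁻¹)) := by
    intro t ht s hs
    rw [hFdef, norm_mul]
    exact mul_le_mul (hM t ht) (norm_rpow_mul_expConv_le hg hM γ hs ht) (norm_nonneg _) hM0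
  have hF : Integrable (Function.uncurry F)
      ((volume.restrict (Ioc 0 T)).prod (volume.restrict (Ioi 0))) := by
    have hbi : Integrable (fun p : ℝ × ℝ => (1 : ℝ) * (M * (M * (p.2 ^ (γ - 1) * min T p.2⁻¹))))
        ((volume.restrict (Ioc 0 T)).prod (volume.restrict (Ioi 0))) :=
      (integrable_const (1 : ℝ)).mul_prod
        (((integrableOn_rpow_mul_min hγ₀ hγ₁ hT).const_mul M).const_mul M)
    refine hbi.mono' hFm.aestronglyMeasurable ?_
    rw [Measure.prod_restrict]
    refine (ae_restrict_iff' (measurableSet_Ioc.prod measurableSet_Ioi)).2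
      (Filter.Eventually.of_forall fun p hp => ?_)
    rw [one_mul]
    exact hb p.1 (Ioc_subset_Icc_self hp.1) p.2 hp.2
  have hin : ∀ s, ∫ t in Ioc 0 T, F t s =
      s ^ (γ - 1) * ∫ t in (0 : ℝ)..T, g t * expConv g s t := by
    intro s
    rw [← intervalIntegral.integral_of_le hT, ← intervalIntegral.integral_const_mul]
    refine intervalIntegral.integral_congr fun t _ => ?_
    simp only [hFdef]
    ring
  constructor
  · exact hF.integral_prod_right.congr (Filter.Eventually.of_forall hin)
  · have hswap := integral_integral_swap hF
    simp_rw [hin] at hswap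
    rw [← hswap, ← intervalIntegral.integral_of_le hT, ← intervalIntegral.integral_const_mul]
    refine intervalIntegral.integral_congr fun t ht => ?_
    rw [uIcc_of_le hT] at ht
    simp only [hFdef]
    rw [integral_const_mul, abel_eq_integral_expConv hγ₀ hγ₁ ht.1 hg]
    ring

theorem integral_mul_expConv_nonneg {g : ℝ → ℝ} (hg : Continuous g) {s T : ℝ} (hs : 0 ≤ s)
    (hT : 0 ≤ T) : 0 ≤ ∫ t in (0 : ℝ)..T, g t * expConv g s t := by
  rw [integral_mul_expConv hg]
  have := intervalIntegral.integral_nonneg (μ := volume) (f := fun t => expConv g s t ^ 2) hT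
    fun t _ => sq_nonneg _
  positivity

theorem integral_mul_abel_nonneg {γ T : ℝ} (hγ₀ : 0 < γ) (hγ₁ : γ < 1) (hT : 0 ≤ T) {g : ℝ → ℝ}
    (hg : Continuous g) :
    0 ≤ ∫ t in (0 : ℝ)..T, g t * ∫ τ in (0 : ℝ)..t, g τ / (t - τ) ^ γ := by
  rw [(integral_mul_abel hγ₀ hγ₁ hT hg).2]
  refine mul_nonneg (inv_nonneg.2 (Real.Gamma_pos_of_pos hγ₀).le)
    (setIntegral_nonneg measurableSet_Ioi fun s (hs : 0 < s) => ?_)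
  exact mul_nonneg (Real.rpow_nonneg hs.le _) (integral_mul_expConv_nonneg hg hs.le hT)

/-- A vanishing integral of nonnegative terms makes the term vanish for almost every rate. One rate
`s > 0` is enough: then `∫ y² = 0`, so `y = 0` on the interval and `g = y' + s y = 0` inside it,
hence up to the end points. -/
theorem eq_zero_of_integral_mul_abel_eq_zero {γ T : ℝ} (hγ₀ : 0 < γ) (hγ₁ : γ < 1) (hT : 0 < T)
    {g : ℝ → ℝ} (hg : Continuous g)
    (h : ∫ t in (0 : ℝ)..T, g t * ∫ τ in (0 : ℝ)..t, g τ / (t - τ) ^ γ = 0) :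
    ∀ t ∈ Icc 0 T, g t = 0 := by
  obtain ⟨hi, he⟩ := integral_mul_abel hγ₀ hγ₁ hT.le hg
  rw [he] at h
  have h1 := (mul_eq_zero.1 h).resolve_left (inv_pos.2 (Real.Gamma_pos_of_pos hγ₀)).ne'
  have h2 : ∀ᵐ s ∂(volume.restrict (Ioi (0 : ℝ))),
      s ^ (γ - 1) * ∫ t in (0 : ℝ)..T, g t * expConv g s t = 0 := by
    refine (setIntegral_eq_zero_iff_of_nonneg_ae ?_ hi).1 h1
    refine (ae_restrict_iff' measurableSet_Ioi).2 (Filter.Eventually.of_forall fun s hs => ?_)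
    exact mul_nonneg (Real.rpow_nonneg (le_of_lt hs) _)
      (integral_mul_expConv_nonneg hg (le_of_lt hs) hT.le)
  obtain ⟨s, hs0, hs⟩ : ∃ s : ℝ, 0 < s ∧
      s ^ (γ - 1) * ∫ t in (0 : ℝ)..T, g t * expConv g s t = 0 := by
    have hne : volume.restrict (Ioi (0 : ℝ)) ≠ 0 := by
      rw [Ne, Measure.restrict_eq_zero]
      simp
    have : (ae (volume.restrict (Ioi (0 : ℝ)))).NeBot := ae_neBot.2 hne
    obtain ⟨s, hs, hs'⟩ := (h2.and (ae_restrict_mem measurableSet_Ioi)).exists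
    exact ⟨s, hs', hs⟩
  have h3 := (mul_eq_zero.1 hs).resolve_left (Real.rpow_pos_of_pos hs0 _).ne'
  rw [integral_mul_expConv hg] at h3
  have hc : Continuous fun t => expConv g s t :=
    (continuous_expConv hg).comp (by fun_prop : Continuous fun t : ℝ => (s, t))
  have h4 : ∫ t in (0 : ℝ)..T, expConv g s t ^ 2 = 0 := by
    have h5 := intervalIntegral.integral_nonneg (μ := volume) (f := fun t => expConv g s t ^ 2)
      hT.le
      fun t _ => sq_nonneg _
    have h6 : 0 ≤ s * ∫ t in (0 : ℝ)..T, expConv g s t ^ 2 := mul_nonneg hs0.le h5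
    have h7 := sq_nonneg (expConv g s T)
    exact (mul_eq_zero.1 (by linarith : s * ∫ t in (0 : ℝ)..T, expConv g s t ^ 2 = 0)).resolve_left
      hs0.ne'
  have hy : ∀ t ∈ Icc 0 T, expConv g s t = 0 := by
    by_contra! hne
    obtain ⟨t, ht, hne⟩ := hne
    have := intervalIntegral.integral_pos (f := fun t => expConv g s t ^ 2) hT
      (by fun_prop) (fun t _ => sq_nonneg _) ⟨t, ht, by positivity⟩
    exact this.ne' h4
  have hoo : ∀ t ∈ Ioo 0 T, g t = 0 := by
    intro t ht
    have hd := hasDerivAt_expConv hg s t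
    have hz : HasDerivAt (expConv g s) 0 t := by
      refine (hasDerivAt_const t (0 : ℝ)).congr_of_eventuallyEq ?_
      filter_upwards [Icc_mem_nhds ht.1 ht.2] with r hr using hy r hr
    have := hd.unique hz
    rwa [hy t (Ioo_subset_Icc_self ht), mul_zero, sub_zero] at this
  have hcl : EqOn g (fun _ => 0) (closure (Ioo 0 T)) :=
    EqOn.closure hoo hg continuous_const
  rwa [closure_Ioo hT.ne] at hcl

/-- If the Abel integral of order `1 - β` of `v` is a primitive of `q`, then `v` is, up to a
constant, the Abel integral of order `β` of `q`. -/
theorem abel_inverse_of_primitive {β T : ℝ} (hβ₀ : 0 < β) (hβ₁ : β < 1) (hT : 0 < T)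
    {v q : ℝ → ℝ} (hv : Continuous v) (hq : Continuous q)
    (h : ∀ t ∈ Icc 0 T, ∫ τ in (0 : ℝ)..t, v τ / (t - τ) ^ β = ∫ τ in (0 : ℝ)..t, q τ) :
    ∀ t ∈ Icc 0 T, abelConst β * v t = ∫ τ in (0 : ℝ)..t, q τ / (t - τ) ^ (1 - β) := by
  have hβ' : 0 < 1 - β := by linarith
  set w : ℝ → ℝ := fun t => ∫ τ in (0 : ℝ)..t, q τ / (t - τ) ^ (1 - β) with hw
  have hwc : ContinuousOn w (Icc 0 T) := continuousOn_abel hβ' (by linarith) hT.le hq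
  -- Apply the kernel of complementary order to both sides of `h`. The left becomes the primitive of
  -- `v` up to the constant, the right the primitive of `w`. Differentiating, which uses only
  -- continuity of `v` and `w`, gives the claim.
  have hint : ∀ t ∈ Icc 0 T, abelConst β * ∫ r in (0 : ℝ)..t, v r = ∫ r in (0 : ℝ)..t, w r := by
    intro t ht
    rw [← abel_inversion hβ₀ hβ₁ ht.1 hv, ← integral_abel_primitive (by linarith) ht.1
      hq.integrableOn_Ioc]
    refine intervalIntegral.integral_congr fun τ hτ => ?_
    rw [uIcc_of_le ht.1] at hτ
    rw [h τ ⟨hτ.1, hτ.2.trans ht.2⟩]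
  have hoo : EqOn (fun t => abelConst β * v t) w (Ioo 0 T) := by
    intro t ht
    have ht' := Ioo_subset_Icc_self ht
    have hnhds := Icc_mem_nhds ht.1 ht.2
    have hd1 : HasDerivAt (fun t => abelConst β * ∫ r in (0 : ℝ)..t, v r) (abelConst β * v t) t :=
      (intervalIntegral.integral_hasDerivAt_right (hv.intervalIntegrable _ _)
        (hv.stronglyMeasurableAtFilter _ _) hv.continuousAt).const_mul _
    have hd2 : HasDerivAt (fun t => ∫ r in (0 : ℝ)..t, w r) (w t) t := by
      refine intervalIntegral.integral_hasDerivAt_right ?_ ?_ (hwc.continuousAt hnhds)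
      · refine ContinuousOn.intervalIntegrable ?_
        rw [uIcc_of_le ht.1.le]
        exact hwc.mono (Icc_subset_Icc_right ht.2.le)
      · exact (hwc.mono Ioo_subset_Icc_self).stronglyMeasurableAtFilter isOpen_Ioo t ht
    refine hd1.unique (hd2.congr_of_eventuallyEq ?_)
    filter_upwards [hnhds] with r hr using hint r hr
  intro t ht
  rw [← closure_Ioo hT.ne] at ht hwc
  exact hoo.of_subset_closure (hv.const_mul _ |>.continuousOn) hwc subset_closure subset_rfl ht

/-! ### Truncation of the identity near zero -/

/-- A continuous cutoff vanishing on `[-ε, ε]` and equal to one off `[-2ε, 2ε]`. -/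
noncomputable def cutoff (ε σ : ℝ) : ℝ := min 1 (max 0 (|σ| / ε - 1))

/-- The primitive of the cutoff: a truncation of the identity near zero. -/
noncomputable def truncId (ε s : ℝ) : ℝ := ∫ σ in (0 : ℝ)..s, cutoff ε σ

theorem continuous_cutoff (ε : ℝ) : Continuous (cutoff ε) := by
  unfold cutoff
  fun_prop

theorem cutoff_nonneg (ε σ : ℝ) : 0 ≤ cutoff ε σ := le_min zero_le_one (le_max_left _ _)

theorem cutoff_le_one (ε σ : ℝ) : cutoff ε σ ≤ 1 := min_le_left _ _

theorem cutoff_of_abs_le {ε σ : ℝ} (hε : 0 < ε) (h : |σ| ≤ ε) : cutoff ε σ = 0 := by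
  have : |σ| / ε ≤ 1 := (div_le_one hε).2 h
  rw [cutoff, max_eq_left (by linarith), min_eq_right zero_le_one]

theorem cutoff_of_two_mul_le {ε σ : ℝ} (hε : 0 < ε) (h : 2 * ε ≤ |σ|) : cutoff ε σ = 1 := by
  have : 2 ≤ |σ| / ε := (le_div_iff₀ hε).2 h
  rw [cutoff, min_eq_left (le_max_of_le_right (by linarith))]

theorem hasDerivAt_truncId (ε s : ℝ) : HasDerivAt (truncId ε) (cutoff ε s) s :=
  intervalIntegral.integral_hasDerivAt_right ((continuous_cutoff ε).intervalIntegrable _ _)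
    ((continuous_cutoff ε).stronglyMeasurableAtFilter _ _) (continuous_cutoff ε).continuousAt

theorem contDiff_truncId (ε : ℝ) : ContDiff ℝ 1 (truncId ε) := by
  rw [contDiff_one_iff_deriv]
  refine ⟨fun s => (hasDerivAt_truncId ε s).differentiableAt, ?_⟩
  rw [show deriv (truncId ε) = cutoff ε from funext fun s => (hasDerivAt_truncId ε s).deriv]
  exact continuous_cutoff ε

theorem truncId_of_abs_le {ε s : ℝ} (hε : 0 < ε) (h : |s| ≤ ε) : truncId ε s = 0 := by
  rw [truncId, intervalIntegral.integral_congr (g := fun _ => 0) fun σ hσ => ?_]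
  · simp
  · have := abs_sub_left_of_mem_uIcc hσ
    simp only [sub_zero] at this
    exact cutoff_of_abs_le hε (this.trans h)

theorem abs_truncId_le (ε s : ℝ) : |truncId ε s| ≤ |s| := by
  have h := intervalIntegral.norm_integral_le_of_norm_le_const (a := 0) (b := s) (C := 1)
    (f := cutoff ε) fun σ _ => by
      rw [Real.norm_of_nonneg (cutoff_nonneg _ _)]
      exact cutoff_le_one _ _
  simpa [truncId] using h

theorem tendsto_cutoff {s : ℝ} (hs : s ≠ 0) :
    Filter.Tendsto (fun n : ℕ => cutoff (1 / ((n : ℝ) + 1)) s) Filter.atTop (nhds 1) := by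
  refine tendsto_const_nhds.congr' ?_
  have h := (tendsto_one_div_add_atTop_nhds_zero_nat (𝕜 := ℝ)).eventually
    (gt_mem_nhds (half_pos (abs_pos.2 hs)))
  filter_upwards [h] with n hn
  exact (cutoff_of_two_mul_le (by positivity) (by linarith)).symm

theorem tendsto_truncId (s : ℝ) :
    Filter.Tendsto (fun n : ℕ => truncId (1 / ((n : ℝ) + 1)) s) Filter.atTop (nhds s) := by
  have h := intervalIntegral.tendsto_integral_filter_of_dominated_convergence
    (a := 0) (b := s) (μ := volume) (l := Filter.atTop)
    (F := fun (n : ℕ) σ => cutoff (1 / ((n : ℝ) + 1)) σ) (f := fun _ => 1) (fun _ => 1)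
    (Filter.Eventually.of_forall fun n => (continuous_cutoff _).aestronglyMeasurable)
    (Filter.Eventually.of_forall fun n => Filter.Eventually.of_forall fun σ _ => by
      rw [Real.norm_of_nonneg (cutoff_nonneg _ _)]
      exact cutoff_le_one _ _)
    (by simp)
    (by
      have : ∀ᵐ σ : ℝ, σ ≠ 0 := by simp [ae_iff]
      filter_upwards [this] with σ hσ _ using tendsto_cutoff hσ)
  simpa [truncId] using h

/-! ### Green's identity without boundary regularity -/

section Elliptic

variable {N : ℕ}

theorem contDiffOn_partialDeriv {Ω : Set (EuclideanSpace ℝ (Fin N))} (hΩ : IsOpen Ω)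
    {u : EuclideanSpace ℝ (Fin N) → ℝ} {m n : WithTop ℕ∞}
    (hu : ContDiffOn ℝ n u Ω) (hmn : m + 1 ≤ n) (i : Fin N) :
    ContDiffOn ℝ m (partialDeriv i u) Ω :=
  (hu.fderiv_of_isOpen hΩ hmn).clm_apply contDiffOn_const

/-- The divergence theorem for a product one of whose factors has compact support in `Ω`. -/
theorem integral_partialDeriv_mul {Ω K : Set (EuclideanSpace ℝ (Fin N))} (hΩ : IsOpen Ω)
    (hK : IsCompact K) (hKΩ : K ⊆ Ω)
    {F g : EuclideanSpace ℝ (Fin N) → ℝ} (hF : ContDiffOn ℝ 1 F Ω) (hg : ContDiffOn ℝ 1 g Ω)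
    (hg0 : ∀ x ∈ Ω, x ∉ K → g x = 0) (i : Fin N) :
    IntegrableOn (fun x => partialDeriv i F x * g x + F x * partialDeriv i g x) Ω ∧
    ∫ x in Ω, (partialDeriv i F x * g x + F x * partialDeriv i g x) = 0 := by
  -- Since `K ⊆ Ω`, every point lies in one of the open sets `Ω` and `Kᶜ`. The extension is the
  -- product on the first and zero on the second, so it is `C¹` on the whole space with compact
  -- support.
  set H : EuclideanSpace ℝ (Fin N) → ℝ := Ω.indicator (fun x => F x * g x) with hH
  have hHK : ∀ x ∉ K, H x = 0 := by
    intro x hx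
    by_cases hxΩ : x ∈ Ω
    · rw [hH, indicator_of_mem hxΩ, hg0 x hxΩ hx, mul_zero]
    · exact indicator_of_notMem hxΩ _
  have hHΩ : ∀ x ∈ Ω, H =ᶠ[nhds x] fun x => F x * g x := by
    intro x hx
    filter_upwards [hΩ.mem_nhds hx] with y hy using indicator_of_mem hy _
  have hHc : ∀ x ∉ K, H =ᶠ[nhds x] fun _ => 0 := by
    intro x hx
    filter_upwards [hK.isClosed.isOpen_compl.mem_nhds hx] with y hy using hHK y hy
  have hHC : ContDiff ℝ 1 H := by
    rw [contDiff_iff_contDiffAt]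
    intro x
    by_cases hxΩ : x ∈ Ω
    · exact (((hF.contDiffAt (hΩ.mem_nhds hxΩ)).mul
        (hg.contDiffAt (hΩ.mem_nhds hxΩ)))).congr_of_eventuallyEq (hHΩ x hxΩ)
    · exact contDiffAt_const.congr_of_eventuallyEq (hHc x fun h => hxΩ (hKΩ h))
  have hHs : HasCompactSupport H := HasCompactSupport.intro hK hHK
  set e : EuclideanSpace ℝ (Fin N) := EuclideanSpace.single i 1 with he
  have hdc : Continuous fun x => fderiv ℝ H x e :=
    (hHC.continuous_fderiv one_ne_zero).clm_apply continuous_const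
  have hdi : Integrable fun x => fderiv ℝ H x e :=
    hdc.integrable_of_hasCompactSupport (hHs.fderiv_apply ℝ e)
  have hHi : Integrable H := hHC.continuous.integrable_of_hasCompactSupport hHs
  -- Integration by parts against the constant function one.
  have h0 : ∫ x, fderiv ℝ H x e = 0 := by
    have h := integral_mul_fderiv_eq_neg_fderiv_mul_of_integrable (𝕜 := ℝ) (μ := volume)
      (f := fun _ : EuclideanSpace ℝ (Fin N) => (1 : ℝ)) (g := H) (v := e)
      (by simp) (by simpa using hdi) (by simpa using hHi)
      (fun x _ => differentiableAt_const _) (fun x _ => hHC.differentiable one_ne_zero x)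
    simpa using h
  have heq : EqOn (fun x => fderiv ℝ H x e)
      (fun x => partialDeriv i F x * g x + F x * partialDeriv i g x) Ω := by
    intro x hx
    have hFd := (hF.contDiffAt (hΩ.mem_nhds hx)).differentiableAt one_ne_zero
    have hgd := (hg.contDiffAt (hΩ.mem_nhds hx)).differentiableAt one_ne_zero
    simp only
    rw [(hHΩ x hx).fderiv_eq, fderiv_fun_mul hFd hgd]
    simp only [add_apply, smul_apply, smul_eq_mul,
      partialDeriv, ← he]
    ring
  refine ⟨hdi.integrableOn.congr_fun heq hΩ.measurableSet, ?_⟩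
  rw [← setIntegral_congr_fun hΩ.measurableSet heq,
    setIntegral_eq_integral_of_forall_compl_eq_zero, h0]
  intro x hx
  rw [(hHc x fun h => hx (hKΩ h)).fderiv_eq]
  simp

/-- The gradient of a differentiable function vanishes almost everywhere on its zero set. -/
theorem ae_partialDeriv_eq_zero {Ω : Set (EuclideanSpace ℝ (Fin N))} (hΩ : IsOpen Ω)
    {u : EuclideanSpace ℝ (Fin N) → ℝ}
    (hu : DifferentiableOn ℝ u Ω) :
    ∀ᵐ x ∂(volume.restrict Ω), u x = 0 → ∀ i, partialDeriv i u x = 0 := by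
  rw [ae_restrict_iff' hΩ.measurableSet]
  set s : Set (EuclideanSpace ℝ (Fin N)) := Ω ∩ u ⁻¹' {0} with hs
  have hsm : MeasurableSet s := by
    have h1 := (hu.continuousOn.isOpen_inter_preimage hΩ (isOpen_compl_singleton (x := (0 : ℝ))))
    have h2 : s = Ω \ (Ω ∩ u ⁻¹' {0}ᶜ) := by
      ext x
      simp only [hs, mem_inter_iff, mem_preimage, mem_singleton_iff, mem_sdiff, mem_compl_iff]
      tauto
    rw [h2]
    exact hΩ.measurableSet.diff h1.measurableSet
  have key : ∀ i : Fin N, ∀ᵐ x : EuclideanSpace ℝ (Fin N), x ∈ s → partialDeriv i u x = 0 := by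
    intro i
    set e : EuclideanSpace ℝ (Fin N) := EuclideanSpace.single i 1 with he
    -- On the zero set this map is approximated by the zero linear map with error constant `0`, so
    -- its derivative vanishes almost everywhere there. Multiplying by `e` makes it a map of the
    -- space to itself, the setting of the differentiation theorem used.
    have hA : ApproximatesLinearOn (fun x => u x • e)
        (0 : EuclideanSpace ℝ (Fin N) →L[ℝ] EuclideanSpace ℝ (Fin N)) s 0 := by
      intro x hx y hy
      have h1 : u x = 0 := hx.2
      have h2 : u y = 0 := hy.2
      simp [h1, h2]
    have h := hA.norm_fderiv_sub_le volume hsm (fun x => (fderiv ℝ u x).smulRight e) fun x hx =>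
      (((hu.differentiableAt (hΩ.mem_nhds hx.1)).hasFDerivAt).smul_const e).hasFDerivWithinAt
    rw [ae_restrict_iff' hsm] at h
    filter_upwards [h] with x hx hxs
    have h1 := hx hxs
    rw [sub_zero, nonpos_iff_eq_zero, nnnorm_eq_zero] at h1
    have h2 := congrArg (fun L : EuclideanSpace ℝ (Fin N) →L[ℝ] EuclideanSpace ℝ (Fin N) => L e) h1
    simp only [ContinuousLinearMap.smulRight_apply, zero_apply] at h2
    exact (smul_eq_zero.1 h2).resolve_right (by simp [he])
  filter_upwards [ae_all_iff.2 key] with x hx hxΩ hux i using hx i ⟨hxΩ, hux⟩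

/-- The component `(A ∇u)_i` of the flux. -/
noncomputable def flux (A : EuclideanSpace ℝ (Fin N) → Matrix (Fin N) (Fin N) ℝ)
    (u : EuclideanSpace ℝ (Fin N) → ℝ) (i : Fin N) (x : EuclideanSpace ℝ (Fin N)) : ℝ :=
  ∑ j, A x i j * partialDeriv j u x

/-- The divergence of the flux `A ∇u`. -/
noncomputable def divFlux (A : EuclideanSpace ℝ (Fin N) → Matrix (Fin N) (Fin N) ℝ)
    (u : EuclideanSpace ℝ (Fin N) → ℝ) (x : EuclideanSpace ℝ (Fin N)) : ℝ :=
  ∑ i, partialDeriv i (flux A u i) x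

/-- The energy density `A ∇u · ∇w`. -/
noncomputable def energyDensity (A : EuclideanSpace ℝ (Fin N) → Matrix (Fin N) (Fin N) ℝ)
    (u w : EuclideanSpace ℝ (Fin N) → ℝ) (x : EuclideanSpace ℝ (Fin N)) : ℝ :=
  ∑ i, flux A u i x * partialDeriv i w x

theorem ellipticOp_eq (A : EuclideanSpace ℝ (Fin N) → Matrix (Fin N) (Fin N) ℝ)
    (c u : EuclideanSpace ℝ (Fin N) → ℝ) (x : EuclideanSpace ℝ (Fin N)) :
    ellipticOp A c u x = divFlux A u x - c x * u x := rfl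

/-- Classical functions with zero boundary values for which `div (A ∇u)` is bounded. -/
structure IsDirichlet (A : EuclideanSpace ℝ (Fin N) → Matrix (Fin N) (Fin N) ℝ)
    (Ω : Set (EuclideanSpace ℝ (Fin N))) (u : EuclideanSpace ℝ (Fin N) → ℝ) : Prop where
  contDiffOn : ContDiffOn ℝ 2 u Ω
  continuousOn : ContinuousOn u (closure Ω)
  boundary : ∀ x ∈ frontier Ω, u x = 0
  bounded : ∃ M, ∀ x ∈ Ω, |divFlux A u x| ≤ M

section Green

variable {A : EuclideanSpace ℝ (Fin N) → Matrix (Fin N) (Fin N) ℝ}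
  {Ω : Set (EuclideanSpace ℝ (Fin N))} {u w : EuclideanSpace ℝ (Fin N) → ℝ}

theorem contDiffOn_flux (hΩ : IsOpen Ω) (hA : ∀ i j, ContDiffOn ℝ 1 (fun x => A x i j) Ω)
    (hu : ContDiffOn ℝ 2 u Ω) (i : Fin N) : ContDiffOn ℝ 1 (flux A u i) Ω :=
  ContDiffOn.sum fun j _ => (hA i j).mul (contDiffOn_partialDeriv hΩ hu (by norm_num) j)

theorem continuousOn_divFlux (hΩ : IsOpen Ω) (hA : ∀ i j, ContDiffOn ℝ 1 (fun x => A x i j) Ω)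
    (hu : ContDiffOn ℝ 2 u Ω) : ContinuousOn (divFlux A u) Ω :=
  continuousOn_finsetSum _ fun i _ =>
    (contDiffOn_partialDeriv (m := 0) hΩ (contDiffOn_flux hΩ hA hu i) (by norm_num) i).continuousOn

theorem continuousOn_energyDensity (hΩ : IsOpen Ω)
    (hA : ∀ i j, ContDiffOn ℝ 1 (fun x => A x i j) Ω)
    (hu : ContDiffOn ℝ 2 u Ω) (hw : ContDiffOn ℝ 2 w Ω) : ContinuousOn (energyDensity A u w) Ω :=
  continuousOn_finsetSum _ fun i _ => (contDiffOn_flux hΩ hA hu i).continuousOn.mul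
    (contDiffOn_partialDeriv (m := 1) hΩ hw (by norm_num) i).continuousOn

theorem energyDensity_comm {x : EuclideanSpace ℝ (Fin N)} (hA : (A x).IsSymm) :
    energyDensity A u w x = energyDensity A w u x := by
  simp only [energyDensity, flux, Finset.sum_mul]
  rw [Finset.sum_comm]
  refine Finset.sum_congr rfl fun i _ => Finset.sum_congr rfl fun j _ => ?_
  rw [hA.apply]
  ring

theorem energyDensity_self_nonneg {x : EuclideanSpace ℝ (Fin N)}
    (hA : ∀ ξ : Fin N → ℝ, 0 ≤ ∑ i, ∑ j, A x i j * ξ i * ξ j) : 0 ≤ energyDensity A u u x := by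
  refine (hA fun i => partialDeriv i u x).trans_eq ?_
  simp only [energyDensity, flux, Finset.sum_mul]
  refine Finset.sum_congr rfl fun i _ => Finset.sum_congr rfl fun j _ => ?_
  ring

/-- Nonnegativity of the form at `∇u + ∇w` and at `∇u - ∇w`, together with symmetry. The bound is
not sharp but supplies an integrable majorant. -/
theorem abs_energyDensity_le {x : EuclideanSpace ℝ (Fin N)} (hsymm : (A x).IsSymm)
    (hA : ∀ ξ : Fin N → ℝ, 0 ≤ ∑ i, ∑ j, A x i j * ξ i * ξ j) :
    |energyDensity A u w x| ≤ energyDensity A u u x + energyDensity A w w x := by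
  have hc := energyDensity_comm (u := u) (w := w) hsymm
  have hu := energyDensity_self_nonneg (u := u) hA
  have hw := energyDensity_self_nonneg (u := w) hA
  have expand : ∀ k : ℝ, ∑ i, ∑ j, A x i j * (partialDeriv i u x + k * partialDeriv i w x) *
      (partialDeriv j u x + k * partialDeriv j w x) = energyDensity A u u x +
      k * energyDensity A u w x + k * energyDensity A w u x + k ^ 2 * energyDensity A w w x := by
    intro k
    simp only [energyDensity, flux, Finset.sum_mul, Finset.mul_sum, ← Finset.sum_add_distrib]
    refine Finset.sum_congr rfl fun i _ => Finset.sum_congr rfl fun j _ => ?_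
    ring
  have h1 := hA fun i => partialDeriv i u x + 1 * partialDeriv i w x
  have h2 := hA fun i => partialDeriv i u x + (-1) * partialDeriv i w x
  rw [expand] at h1 h2
  rw [abs_le]
  constructor <;> linarith

/-- The function `w` is continuous on the compact closure and zero on the boundary, so `{|w| ≥ ε}`
is a compact subset of `Ω`. Off this set the test function `truncId ε ∘ w` vanishes, and the
divergence theorem needs no information about the boundary. -/
theorem green_truncated (hΩ : IsOpen Ω) (hΩb : Bornology.IsBounded Ω)
    (hA : ∀ i j, ContDiffOn ℝ 1 (fun x => A x i j) Ω) (hu : ContDiffOn ℝ 2 u Ω)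
    (hw : IsDirichlet A Ω w) {ε : ℝ} (hε : 0 < ε) :
    IntegrableOn (fun x => divFlux A u x * truncId ε (w x) +
      energyDensity A u w x * cutoff ε (w x)) Ω ∧
    ∫ x in Ω, (divFlux A u x * truncId ε (w x) + energyDensity A u w x * cutoff ε (w x)) = 0 := by
  set K : Set (EuclideanSpace ℝ (Fin N)) := {x ∈ closure Ω | ε ≤ |w x|} with hKdef
  have hKc : IsCompact K := by
    have hcl : IsClosed K :=
      hw.continuousOn.abs.preimage_isClosed_of_isClosed isClosed_closure isClosed_Ici
    exact hΩb.isCompact_closure.of_isClosed_subset hcl (sep_subset _ _)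
  have hKΩ : K ⊆ Ω := by
    intro x hx
    by_contra hxΩ
    have hf : x ∈ frontier Ω := ⟨hx.1, fun h => hxΩ (interior_subset h)⟩
    have := hx.2
    rw [hw.boundary x hf, abs_zero] at this
    linarith
  set g : EuclideanSpace ℝ (Fin N) → ℝ := fun x => truncId ε (w x) with hg
  have hgC : ContDiffOn ℝ 1 g Ω :=
    (contDiff_truncId ε).comp_contDiffOn (hw.contDiffOn.of_le one_le_two)
  have hg0 : ∀ x ∈ Ω, x ∉ K → g x = 0 := by
    intro x hx hxK
    refine truncId_of_abs_le hε (not_lt.1 fun h => hxK ⟨subset_closure hx, h.le⟩)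
  have hgd : ∀ x ∈ Ω, ∀ i, partialDeriv i g x = cutoff ε (w x) * partialDeriv i w x := by
    intro x hx i
    have hwd := (hw.contDiffOn.contDiffAt (hΩ.mem_nhds hx)).differentiableAt two_ne_zero
    have h := (hasDerivAt_truncId ε (w x)).comp_hasFDerivAt x hwd.hasFDerivAt
    rw [partialDeriv, show fderiv ℝ g x = _ from h.fderiv]
    rfl
  have hi := fun i => integral_partialDeriv_mul hΩ hKc hKΩ (contDiffOn_flux hΩ hA hu i) hgC hg0 i
  have heq : EqOn (fun x => ∑ i, (partialDeriv i (flux A u i) x * g x +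
      flux A u i x * partialDeriv i g x))
      (fun x => divFlux A u x * truncId ε (w x) + energyDensity A u w x * cutoff ε (w x)) Ω := by
    intro x hx
    simp only [divFlux, energyDensity, Finset.sum_mul, ← Finset.sum_add_distrib, hgd x hx]
    refine Finset.sum_congr rfl fun i _ => ?_
    simp only [hg]
    ring
  have hsum : IntegrableOn (fun x => ∑ i, (partialDeriv i (flux A u i) x * g x +
      flux A u i x * partialDeriv i g x)) Ω := integrable_finsetSum _ fun i _ => (hi i).1
  refine ⟨hsum.congr_fun heq hΩ.measurableSet, ?_⟩
  rw [← setIntegral_congr_fun hΩ.measurableSet heq, integral_finsetSum _ fun i _ => (hi i).1]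
  exact Finset.sum_eq_zero fun i _ => (hi i).2

theorem IsDirichlet.exists_abs_le (hw : IsDirichlet A Ω w) (hΩb : Bornology.IsBounded Ω) :
    ∃ M, ∀ x ∈ Ω, |w x| ≤ M := by
  obtain ⟨M, hM⟩ := hΩb.isCompact_closure.exists_bound_of_continuousOn hw.continuousOn
  exact ⟨M, fun x hx => hM x (subset_closure hx)⟩

/-- A function continuous and bounded on a bounded open set is integrable on it. -/
theorem integrableOn_of_bounded (hΩ : IsOpen Ω) (hΩb : Bornology.IsBounded Ω)
    {F : EuclideanSpace ℝ (Fin N) → ℝ} (hF : ContinuousOn F Ω) {M : ℝ} (hM : ∀ x ∈ Ω, |F x| ≤ M) :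
    IntegrableOn F Ω :=
  IntegrableOn.of_bound hΩb.measure_lt_top (hF.aestronglyMeasurable hΩ.measurableSet) M
    ((ae_restrict_iff' hΩ.measurableSet).2 (Filter.Eventually.of_forall hM))

/-- The bound does not depend on `ε`, because `|truncId ε (w x)| ≤ |w x|`. This uniformity drives
both limits as `ε → 0`. -/
theorem integrableOn_divFlux_mul_truncId (hΩ : IsOpen Ω) (hΩb : Bornology.IsBounded Ω)
    (hA : ∀ i j, ContDiffOn ℝ 1 (fun x => A x i j) Ω) (hu : IsDirichlet A Ω u)
    (hw : IsDirichlet A Ω w) :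
    ∃ M, (∀ ε, ∀ x ∈ Ω, |divFlux A u x * truncId ε (w x)| ≤ M) ∧
      ∀ ε, IntegrableOn (fun x => divFlux A u x * truncId ε (w x)) Ω := by
  obtain ⟨M₁, h₁⟩ := hu.bounded
  obtain ⟨M₂, h₂⟩ := hw.exists_abs_le hΩb
  have hb : ∀ ε, ∀ x ∈ Ω, |divFlux A u x * truncId ε (w x)| ≤ M₁ * M₂ := by
    intro ε x hx
    rw [abs_mul]
    exact mul_le_mul (h₁ x hx) ((abs_truncId_le _ _).trans (h₂ x hx)) (abs_nonneg _)
      ((abs_nonneg _).trans (h₁ x hx))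
  exact ⟨M₁ * M₂, hb, fun ε => integrableOn_of_bounded hΩ hΩb
    ((continuousOn_divFlux hΩ hA hu.contDiffOn).mul
      ((contDiff_truncId ε).continuous.comp_continuousOn hw.contDiffOn.continuousOn)) (hb ε)⟩

theorem integral_energyDensity_mul_cutoff (hΩ : IsOpen Ω) (hΩb : Bornology.IsBounded Ω)
    (hA : ∀ i j, ContDiffOn ℝ 1 (fun x => A x i j) Ω) (hu : IsDirichlet A Ω u)
    (hw : IsDirichlet A Ω w) {ε : ℝ} (hε : 0 < ε) :
    IntegrableOn (fun x => energyDensity A u w x * cutoff ε (w x)) Ω ∧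
    ∫ x in Ω, energyDensity A u w x * cutoff ε (w x) =
      -∫ x in Ω, divFlux A u x * truncId ε (w x) := by
  obtain ⟨M, -, hi⟩ := integrableOn_divFlux_mul_truncId hΩ hΩb hA hu hw
  obtain ⟨h1, h2⟩ := green_truncated hΩ hΩb hA hu.contDiffOn hw hε
  have h3 : IntegrableOn (fun x => energyDensity A u w x * cutoff ε (w x)) Ω := by
    refine (h1.sub (hi ε)).congr (Filter.Eventually.of_forall fun x => ?_)
    simp
  refine ⟨h3, ?_⟩
  rw [integral_add (hi ε) h3] at h2
  linarith

/-- Where `w ≠ 0` the cutoff tends to one. Where `w = 0` the cutoff is always zero, but there `∇w =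
0` almost everywhere, so the limit is zero as well. -/
theorem tendsto_energyDensity_mul_cutoff (hΩ : IsOpen Ω) (hw : ContDiffOn ℝ 2 w Ω) :
    ∀ᵐ x ∂(volume.restrict Ω), Filter.Tendsto
      (fun n : ℕ => energyDensity A u w x * cutoff (1 / ((n : ℝ) + 1)) (w x)) Filter.atTop
      (nhds (energyDensity A u w x)) := by
  filter_upwards [ae_partialDeriv_eq_zero hΩ (hw.differentiableOn two_ne_zero)] with x hx
  by_cases h : w x = 0
  · have : energyDensity A u w x = 0 := by simp [energyDensity, hx h]
    simp [this]
  · simpa using (tendsto_cutoff h).const_mul (energyDensity A u w x)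

/-- No bound on `∇u` near the boundary is available. By the truncated identity the truncated
energies are at most `M |Ω|` uniformly in `n`, and Fatou's lemma passes this to the limit. -/
theorem integrableOn_energyDensity_self (hΩ : IsOpen Ω) (hΩb : Bornology.IsBounded Ω)
    (hA : ∀ i j, ContDiffOn ℝ 1 (fun x => A x i j) Ω)
    (hpos : ∀ x ∈ Ω, ∀ ξ : Fin N → ℝ, 0 ≤ ∑ i, ∑ j, A x i j * ξ i * ξ j)
    (hu : IsDirichlet A Ω u) : IntegrableOn (energyDensity A u u) Ω := by
  obtain ⟨M, hM, hMi⟩ := integrableOn_divFlux_mul_truncId hΩ hΩb hA hu hu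
  have hcont := continuousOn_energyDensity hΩ hA hu.contDiffOn hu.contDiffOn
  have hnn : 0 ≤ᵐ[volume.restrict Ω] energyDensity A u u :=
    (ae_restrict_iff' hΩ.measurableSet).2
      (Filter.Eventually.of_forall fun x hx => energyDensity_self_nonneg (hpos x hx))
  refine ⟨hcont.aestronglyMeasurable hΩ.measurableSet, ?_⟩
  rw [hasFiniteIntegral_iff_ofReal hnn]
  set F : ℕ → EuclideanSpace ℝ (Fin N) → ℝ := fun n x =>
    energyDensity A u u x * cutoff (1 / ((n : ℝ) + 1)) (u x) with hF
  have hlim : ∫⁻ x in Ω, ENNReal.ofReal (energyDensity A u u x) ≤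
      Filter.liminf (fun n => ∫⁻ x in Ω, ENNReal.ofReal (F n x)) Filter.atTop := by
    refine le_trans (lintegral_mono_ae ?_) (lintegral_liminf_le' fun n => ?_)
    · filter_upwards [tendsto_energyDensity_mul_cutoff (A := A) (u := u) hΩ hu.contDiffOn] with x hx
      exact ((ENNReal.continuous_ofReal.tendsto _).comp hx).liminf_eq.symm.le
    · exact (integral_energyDensity_mul_cutoff hΩ hΩb hA hu hu
        (by positivity)).1.aestronglyMeasurable.aemeasurable.ennreal_ofReal
  have hle : ∀ n, ∫⁻ x in Ω, ENNReal.ofReal (F n x) ≤ ENNReal.ofReal (M * volume.real Ω) := by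
    intro n
    obtain ⟨h1, h2⟩ := integral_energyDensity_mul_cutoff hΩ hΩb hA hu hu
      (ε := 1 / ((n : ℝ) + 1)) (by positivity)
    rw [← ofReal_integral_eq_lintegral_ofReal h1, h2]
    · refine ENNReal.ofReal_le_ofReal ((neg_le_abs _).trans ?_)
      rw [← Real.norm_eq_abs]
      exact norm_setIntegral_le_of_norm_le_const hΩb.measure_lt_top (hM _)
    · filter_upwards [hnn] with x hx using mul_nonneg hx (cutoff_nonneg _ _)
  calc ∫⁻ x in Ω, ENNReal.ofReal (energyDensity A u u x)
      ≤ _ := hlim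
    _ ≤ ENNReal.ofReal (M * volume.real Ω) :=
        Filter.liminf_le_of_le (by isBoundedDefault) fun b hb => by
          obtain ⟨n, hn⟩ := hb.exists
          exact hn.trans (hle n)
    _ < ⊤ := ENNReal.ofReal_lt_top

/-- Green's first identity. -/
theorem integral_divFlux_mul (hΩ : IsOpen Ω) (hΩb : Bornology.IsBounded Ω)
    (hA : ∀ i j, ContDiffOn ℝ 1 (fun x => A x i j) Ω) (hsymm : ∀ x ∈ Ω, (A x).IsSymm)
    (hpos : ∀ x ∈ Ω, ∀ ξ : Fin N → ℝ, 0 ≤ ∑ i, ∑ j, A x i j * ξ i * ξ j)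
    (hu : IsDirichlet A Ω u) (hw : IsDirichlet A Ω w) :
    ∫ x in Ω, divFlux A u x * w x = -∫ x in Ω, energyDensity A u w x := by
  obtain ⟨M, hM, hMi⟩ := integrableOn_divFlux_mul_truncId hΩ hΩb hA hu hw
  have hae : ∀ {p : EuclideanSpace ℝ (Fin N) → Prop}, (∀ x ∈ Ω, p x) →
      ∀ᵐ x ∂(volume.restrict Ω), p x := fun h =>
    (ae_restrict_iff' hΩ.measurableSet).2 (Filter.Eventually.of_forall h)
  have h1 : Filter.Tendsto
      (fun n : ℕ => ∫ x in Ω, divFlux A u x * truncId (1 / ((n : ℝ) + 1)) (w x))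
      Filter.atTop (nhds (∫ x in Ω, divFlux A u x * w x)) := by
    refine tendsto_integral_of_dominated_convergence (fun _ => M)
      (fun n => (hMi _).aestronglyMeasurable) ?_ (fun n => hae (hM _))
      (Filter.Eventually.of_forall fun x => (tendsto_truncId (w x)).const_mul _)
    have : IsFiniteMeasure (volume.restrict Ω) := ⟨by simpa using hΩb.measure_lt_top⟩
    exact integrable_const M
  have h2 : Filter.Tendsto (fun n : ℕ => ∫ x in Ω, energyDensity A u w x *
      cutoff (1 / ((n : ℝ) + 1)) (w x)) Filter.atTop (nhds (∫ x in Ω, energyDensity A u w x)) := by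
    -- The finite energies of `u` and `w` dominate the mixed density.
    refine tendsto_integral_of_dominated_convergence
      (fun x => energyDensity A u u x + energyDensity A w w x)
      (fun n => (integral_energyDensity_mul_cutoff hΩ hΩb hA hu hw
        (by positivity)).1.aestronglyMeasurable)
      ((integrableOn_energyDensity_self hΩ hΩb hA hpos hu).add
        (integrableOn_energyDensity_self hΩ hΩb hA hpos hw))
      (fun n => hae fun x hx => ?_) (tendsto_energyDensity_mul_cutoff hΩ hw.contDiffOn)
    rw [norm_mul, Real.norm_of_nonneg (cutoff_nonneg _ _)]
    exact (mul_le_of_le_one_right (norm_nonneg _) (cutoff_le_one _ _)).trans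
      (abs_energyDensity_le (hsymm x hx) (hpos x hx))
  refine tendsto_nhds_unique h1 ?_
  refine (h2.neg).congr fun n => ?_
  rw [(integral_energyDensity_mul_cutoff hΩ hΩb hA hu hw (by positivity)).2, neg_neg]

theorem IsDirichlet.integrableOn_divFlux_mul (hΩ : IsOpen Ω) (hΩb : Bornology.IsBounded Ω)
    (hA : ∀ i j, ContDiffOn ℝ 1 (fun x => A x i j) Ω) (hu : IsDirichlet A Ω u)
    (hw : IsDirichlet A Ω w) : IntegrableOn (fun x => divFlux A u x * w x) Ω := by
  obtain ⟨M₁, h₁⟩ := hu.bounded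
  obtain ⟨M₂, h₂⟩ := hw.exists_abs_le hΩb
  refine integrableOn_of_bounded hΩ hΩb (M := M₁ * M₂)
    ((continuousOn_divFlux hΩ hA hu.contDiffOn).mul hw.contDiffOn.continuousOn) fun x hx => ?_
  rw [abs_mul]
  exact mul_le_mul (h₁ x hx) (h₂ x hx) (abs_nonneg _) ((abs_nonneg _).trans (h₁ x hx))

variable {c : EuclideanSpace ℝ (Fin N) → ℝ}

theorem IsDirichlet.integrableOn_mul_mul (hΩb : Bornology.IsBounded Ω)
    (hc : ContinuousOn c (closure Ω)) (hu : IsDirichlet A Ω u) (hw : IsDirichlet A Ω w) :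
    IntegrableOn (fun x => c x * u x * w x) Ω :=
  (((hc.mul hu.continuousOn).mul hw.continuousOn).integrableOn_compact
    hΩb.isCompact_closure).mono_set subset_closure

/-- The elliptic operator is symmetric on functions with zero boundary values. -/
theorem integral_ellipticOp_mul_comm (hΩ : IsOpen Ω) (hΩb : Bornology.IsBounded Ω)
    (hA : ∀ i j, ContDiffOn ℝ 1 (fun x => A x i j) Ω) (hsymm : ∀ x ∈ Ω, (A x).IsSymm)
    (hpos : ∀ x ∈ Ω, ∀ ξ : Fin N → ℝ, 0 ≤ ∑ i, ∑ j, A x i j * ξ i * ξ j)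
    (hc : ContinuousOn c (closure Ω)) (hu : IsDirichlet A Ω u) (hw : IsDirichlet A Ω w) :
    ∫ x in Ω, ellipticOp A c u x * w x = ∫ x in Ω, ellipticOp A c w x * u x := by
  simp only [ellipticOp_eq, sub_mul]
  rw [integral_sub (hu.integrableOn_divFlux_mul hΩ hΩb hA hw)
      (hu.integrableOn_mul_mul hΩb hc hw),
    integral_sub (hw.integrableOn_divFlux_mul hΩ hΩb hA hu)
      (hw.integrableOn_mul_mul hΩb hc hu),
    integral_divFlux_mul hΩ hΩb hA hsymm hpos hu hw,
    integral_divFlux_mul hΩ hΩb hA hsymm hpos hw hu,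
    setIntegral_congr_fun hΩ.measurableSet fun x hx => energyDensity_comm (hsymm x hx)]
  congr 1
  refine integral_congr_ae (Filter.Eventually.of_forall fun x => ?_)
  simp only
  ring

/-- The elliptic operator is nonpositive on functions with zero boundary values. -/
theorem integral_ellipticOp_mul_self_nonpos (hΩ : IsOpen Ω) (hΩb : Bornology.IsBounded Ω)
    (hA : ∀ i j, ContDiffOn ℝ 1 (fun x => A x i j) Ω) (hsymm : ∀ x ∈ Ω, (A x).IsSymm)
    (hpos : ∀ x ∈ Ω, ∀ ξ : Fin N → ℝ, 0 ≤ ∑ i, ∑ j, A x i j * ξ i * ξ j)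
    (hc : ContinuousOn c (closure Ω)) (hc0 : ∀ x ∈ Ω, 0 ≤ c x) (hu : IsDirichlet A Ω u) :
    ∫ x in Ω, ellipticOp A c u x * u x ≤ 0 := by
  simp only [ellipticOp_eq, sub_mul]
  rw [integral_sub (hu.integrableOn_divFlux_mul hΩ hΩb hA hu)
      (hu.integrableOn_mul_mul hΩb hc hu), integral_divFlux_mul hΩ hΩb hA hsymm hpos hu hu]
  have h1 : 0 ≤ ∫ x in Ω, energyDensity A u u x :=
    setIntegral_nonneg hΩ.measurableSet fun x hx => energyDensity_self_nonneg (hpos x hx)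
  have h2 : 0 ≤ ∫ x in Ω, c x * u x * u x :=
    setIntegral_nonneg hΩ.measurableSet fun x hx => by
      rw [mul_assoc]
      exact mul_nonneg (hc0 x hx) (mul_self_nonneg _)
  linarith

end Green

end Elliptic

/-! ### Sign of the pairing of a velocity with its fractional derivative -/

theorem exists_continuous_extension_Icc {T : ℝ} (hT : 0 ≤ T) {g : ℝ → ℝ}
    (hg : ContinuousOn g (Icc 0 T)) : ∃ g' : ℝ → ℝ, Continuous g' ∧ EqOn g' g (Icc 0 T) :=
  ⟨IccExtend hT ((Icc 0 T).domRestrict g),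
    (continuousOn_iff_continuous_domRestrict.1 hg).Icc_extend',
    fun _ ht => IccExtend_of_mem hT _ ht⟩

/-- Positivity of the pairing of a function with the derivative of its Abel integral. -/
theorem integral_mul_nonneg_of_abel_primitive {β T κ : ℝ} (hβ₀ : 0 < β) (hβ₁ : β < 1)
    (hT : 0 < T) (hκ : 0 < κ) {v q : ℝ → ℝ} (hv : ContinuousOn v (Icc 0 T))
    (hq : ContinuousOn q (Icc 0 T))
    (h : ∀ t ∈ Icc 0 T, ∫ τ in (0 : ℝ)..t, v τ / (t - τ) ^ β = κ * ∫ τ in (0 : ℝ)..t, q τ) :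
    0 ≤ ∫ t in (0 : ℝ)..T, q t * v t ∧
      (∫ t in (0 : ℝ)..T, q t * v t = 0 → ∀ t ∈ Icc 0 T, q t = 0 ∧ v t = 0) := by
  obtain ⟨v', hv'c, hv'⟩ := exists_continuous_extension_Icc hT.le hv
  obtain ⟨q', hq'c, hq'⟩ := exists_continuous_extension_Icc hT.le hq
  have hB := abelConst_pos hβ₀ hβ₁
  have hinv := abel_inverse_of_primitive hβ₀ hβ₁ hT hv'c (hq'c.const_mul κ) fun t ht => by
    have e1 : ∫ τ in (0 : ℝ)..t, v' τ / (t - τ) ^ β = ∫ τ in (0 : ℝ)..t, v τ / (t - τ) ^ β := by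
      refine intervalIntegral.integral_congr fun τ hτ => ?_
      rw [uIcc_of_le ht.1] at hτ
      simp only [hv' ⟨hτ.1, hτ.2.trans ht.2⟩]
    have e2 : ∫ τ in (0 : ℝ)..t, q' τ = ∫ τ in (0 : ℝ)..t, q τ := by
      refine intervalIntegral.integral_congr fun τ hτ => ?_
      rw [uIcc_of_le ht.1] at hτ
      exact hq' ⟨hτ.1, hτ.2.trans ht.2⟩
    rw [e1, h t ht, intervalIntegral.integral_const_mul, e2]
  -- Since `abelConst β * v` is the Abel integral of `κ q`, the pairing of `q` with `v` is a
  -- positive multiple of the quadratic form of the Abel kernel at `κ q`.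
  have e : ∫ t in (0 : ℝ)..T, (κ * q' t) * ∫ τ in (0 : ℝ)..t, (κ * q' τ) / (t - τ) ^ (1 - β) =
      κ * abelConst β * ∫ t in (0 : ℝ)..T, q t * v t := by
    rw [← intervalIntegral.integral_const_mul]
    refine intervalIntegral.integral_congr fun t ht => ?_
    rw [uIcc_of_le hT.le] at ht
    rw [← hinv t ht, hv' ht, hq' ht]
    ring
  have hκB : 0 < κ * abelConst β := mul_pos hκ hB
  constructor
  · have h0 := integral_mul_abel_nonneg (γ := 1 - β) (by linarith) (by linarith) hT.le
      (hq'c.const_mul κ)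
    rw [e] at h0
    exact nonneg_of_mul_nonneg_right h0 hκB
  · intro hz
    rw [hz, mul_zero] at e
    have hq0 := eq_zero_of_integral_mul_abel_eq_zero (γ := 1 - β) (by linarith) (by linarith) hT
      (hq'c.const_mul κ) e
    intro t ht
    refine ⟨?_, ?_⟩
    · rw [← hq' ht]
      exact (mul_eq_zero.1 (hq0 t ht)).resolve_left hκ.ne'
    · have h1 := hinv t ht
      rw [intervalIntegral.integral_congr (g := fun _ => 0) fun τ hτ => ?_] at h1
      · rw [intervalIntegral.integral_zero, hv' ht] at h1
        exact (mul_eq_zero.1 h1).resolve_left hB.ne'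
      · rw [uIcc_of_le ht.1] at hτ
        simp only [hq0 τ ⟨hτ.1, hτ.2.trans ht.2⟩, zero_div]

/-! ### Energy argument on the space-time cylinder -/

section Cylinder

variable {N : ℕ} {T : ℝ} {Ω : Set (EuclideanSpace ℝ (Fin N))}
  {F : ℝ → EuclideanSpace ℝ (Fin N) → ℝ}

theorem continuousOn_slice_space
    (hF : ContinuousOn (Function.uncurry F) (Icc 0 T ×ˢ closure Ω)) {t : ℝ} (ht : t ∈ Icc 0 T) :
    ContinuousOn (F t) (closure Ω) :=
  hF.comp (f := fun x => (t, x)) (by fun_prop) fun _ hx => ⟨ht, hx⟩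

theorem continuousOn_slice_time
    (hF : ContinuousOn (Function.uncurry F) (Icc 0 T ×ˢ closure Ω))
    {x : EuclideanSpace ℝ (Fin N)} (hx : x ∈ closure Ω) :
    ContinuousOn (fun t => F t x) (Icc 0 T) :=
  hF.comp (f := fun t => (t, x)) (by fun_prop) fun _ ht => ⟨ht, hx⟩

theorem exists_bound_cylinder (hΩb : Bornology.IsBounded Ω)
    (hF : ContinuousOn (Function.uncurry F) (Icc 0 T ×ˢ closure Ω)) :
    ∃ M, 0 ≤ M ∧ ∀ t ∈ Icc 0 T, ∀ x ∈ closure Ω, |F t x| ≤ M := by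
  obtain ⟨M, hM⟩ := (isCompact_Icc.prod hΩb.isCompact_closure).exists_bound_of_continuousOn hF
  exact ⟨max M 0, le_max_right _ _, fun t ht x hx =>
    (hM (t, x) ⟨ht, hx⟩).trans (le_max_left _ _)⟩

theorem aestronglyMeasurable_slice (hΩ : IsOpen Ω)
    (hF : ContinuousOn (Function.uncurry F) (Icc 0 T ×ˢ closure Ω)) {t : ℝ} (ht : t ∈ Icc 0 T) :
    AEStronglyMeasurable (F t) (volume.restrict Ω) :=
  ((continuousOn_slice_space hF ht).mono subset_closure).aestronglyMeasurable hΩ.measurableSet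

theorem continuousOn_integral_slice (hΩ : IsOpen Ω) (hΩb : Bornology.IsBounded Ω)
    (hF : ContinuousOn (Function.uncurry F) (Icc 0 T ×ˢ closure Ω)) :
    ContinuousOn (fun t => ∫ x in Ω, F t x) (Icc 0 T) := by
  obtain ⟨M, -, hM⟩ := exists_bound_cylinder hΩb hF
  have : IsFiniteMeasure (volume.restrict Ω) := ⟨by simpa using hΩb.measure_lt_top⟩
  refine continuousOn_of_dominated (bound := fun _ => M)
    (fun t ht => aestronglyMeasurable_slice hΩ hF ht) (fun t ht => ?_) (integrable_const M) ?_
  · exact (ae_restrict_iff' hΩ.measurableSet).2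
      (Filter.Eventually.of_forall fun x hx => hM t ht x (subset_closure hx))
  · exact (ae_restrict_iff' hΩ.measurableSet).2
      (Filter.Eventually.of_forall fun x hx => continuousOn_slice_time hF (subset_closure hx))

theorem integral_cylinder_swap (hT : 0 ≤ T) (hΩb : Bornology.IsBounded Ω)
    (hF : ContinuousOn (Function.uncurry F) (Icc 0 T ×ˢ closure Ω)) :
    IntegrableOn (fun x => ∫ t in (0 : ℝ)..T, F t x) Ω ∧
    ∫ x in Ω, (∫ t in (0 : ℝ)..T, F t x) = ∫ t in (0 : ℝ)..T, ∫ x in Ω, F t x := by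
  have hi : Integrable (Function.uncurry F)
      ((volume.restrict (Ioc 0 T)).prod (volume.restrict Ω)) := by
    rw [Measure.prod_restrict]
    have h := hF.integrableOn_compact (μ := volume.prod volume)
      (isCompact_Icc.prod hΩb.isCompact_closure)
    exact h.mono_set (prod_mono Ioc_subset_Icc_self subset_closure)
  simp only [intervalIntegral.integral_of_le hT]
  exact ⟨hi.integral_prod_right, (integral_integral_swap hi).symm⟩

section Energy

variable {u v Λ : ℝ → EuclideanSpace ℝ (Fin N) → ℝ}

/-- Differentiation of a symmetric time dependent pairing. -/
theorem hasDerivAt_integral_mul_of_symm (hΩ : IsOpen Ω) (hΩb : Bornology.IsBounded Ω)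
    (hu : ContinuousOn (Function.uncurry u) (Icc 0 T ×ˢ closure Ω))
    (hv : ContinuousOn (Function.uncurry v) (Icc 0 T ×ˢ closure Ω))
    (hΛ : ContinuousOn (Function.uncurry Λ) (Icc 0 T ×ˢ closure Ω))
    (hd : ∀ x ∈ closure Ω, ∀ t ∈ Icc 0 T,
      HasDerivWithinAt (fun s => u s x) (v t x) (Icc 0 T) t)
    (hsymm : ∀ s ∈ Ioc 0 T, ∀ t ∈ Ioc 0 T, ∫ x in Ω, Λ s x * u t x = ∫ x in Ω, Λ t x * u s x)
    {t : ℝ} (ht : t ∈ Ioo 0 T) :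
    HasDerivAt (fun s => ∫ x in Ω, Λ s x * u s x) (∫ x in Ω, 2 * (Λ t x * v t x)) t := by
  obtain ⟨M, hM0, hM⟩ := exists_bound_cylinder hΩb hΛ
  obtain ⟨V, hV0, hV⟩ := exists_bound_cylinder hΩb hv
  have : IsFiniteMeasure (volume.restrict Ω) := ⟨by simpa using hΩb.measure_lt_top⟩
  have htI : t ∈ Icc 0 T := Ioo_subset_Icc_self ht
  have hae : ∀ {p : EuclideanSpace ℝ (Fin N) → Prop}, (∀ x ∈ Ω, p x) →
      ∀ᵐ x ∂(volume.restrict Ω), p x := fun h =>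
    (ae_restrict_iff' hΩ.measurableSet).2 (Filter.Eventually.of_forall h)
  have hmul : ∀ s ∈ Icc 0 T, ∀ r ∈ Icc 0 T, IntegrableOn (fun x => Λ s x * u r x) Ω := by
    intro s hs r hr
    exact (((continuousOn_slice_space hΛ hs).mul
      (continuousOn_slice_space hu hr)).integrableOn_compact hΩb.isCompact_closure).mono_set
      subset_closure
  have hnear : ∀ᶠ s in nhdsWithin t {t}ᶜ, s ∈ Ioo 0 T :=
    nhdsWithin_le_nhds (Ioo_mem_nhds ht.1 ht.2)
  rw [hasDerivAt_iff_tendsto_slope]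
  -- `Λ` need not be differentiable in time. Symmetry cancels the cross terms in `∫ (Λ s + Λ t)(u s
  -- - u t)`, leaving the increment of `∫ Λ u`, so only `u` is differentiated and `Λ` merely has to
  -- be continuous.
  have hlim : Filter.Tendsto
      (fun s => ∫ x in Ω, (Λ s x + Λ t x) * slope (fun r => u r x) t s)
      (nhdsWithin t {t}ᶜ) (nhds (∫ x in Ω, 2 * (Λ t x * v t x))) := by
    refine tendsto_integral_filter_of_dominated_convergence (fun _ => (M + M) * V) ?_ ?_
      (integrable_const _) (hae fun x hx => ?_)
    · filter_upwards [hnear] with s hs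
      have hsI := Ioo_subset_Icc_self hs
      simp only [slope_def_field, div_eq_mul_inv]
      have h1 := aestronglyMeasurable_slice hΩ hΛ hsI
      have h2 := aestronglyMeasurable_slice hΩ hΛ htI
      have h3 := aestronglyMeasurable_slice hΩ hu hsI
      have h4 := aestronglyMeasurable_slice hΩ hu htI
      exact (h1.add h2).mul ((h3.sub h4).mul_const _)
    · filter_upwards [hnear] with s hs
      have hsI := Ioo_subset_Icc_self hs
      refine hae fun x hx => ?_
      have hxc := subset_closure hx
      rw [norm_mul]
      refine mul_le_mul ((abs_add_le _ _).trans (add_le_add (hM s hsI x hxc) (hM t htI x hxc)))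
        ?_ (norm_nonneg _) (by linarith)
      rw [slope_def_field, norm_div]
      have h := Convex.norm_image_sub_le_of_norm_hasDerivWithin_le (hd x hxc)
        (fun r hr => hV r hr x hxc) (convex_Icc 0 T) htI hsI
      exact div_le_of_le_mul₀ (norm_nonneg _) hV0 h
    · have hxc := subset_closure hx
      have hI := Icc_mem_nhds ht.1 ht.2
      have h1 : Filter.Tendsto (fun s => Λ s x) (nhdsWithin t {t}ᶜ) (nhds (Λ t x)) :=
        ((continuousOn_slice_time hΛ hxc).continuousAt hI).tendsto.mono_left nhdsWithin_le_nhds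
      have h2 := ((hd x hxc t htI).hasDerivAt hI).tendsto_slope
      have h3 := (h1.add_const (Λ t x)).mul h2
      rwa [← two_mul, mul_assoc] at h3
  refine hlim.congr' ?_
  filter_upwards [hnear] with s hs
  have hsI := Ioo_subset_Icc_self hs
  have hs' : s ∈ Ioc 0 T := Ioo_subset_Ioc_self hs
  have ht' : t ∈ Ioc 0 T := Ioo_subset_Ioc_self ht
  have e : ∀ x, (Λ s x + Λ t x) * slope (fun r => u r x) t s =
      (s - t)⁻¹ * ((Λ s x * u s x - Λ t x * u t x) + (Λ t x * u s x - Λ s x * u t x)) := by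
    intro x
    rw [slope_def_field]
    ring
  simp_rw [e]
  have i1 : IntegrableOn (fun x => Λ s x * u s x - Λ t x * u t x) Ω :=
    (hmul s hsI s hsI).sub (hmul t htI t htI)
  have i2 : IntegrableOn (fun x => Λ t x * u s x - Λ s x * u t x) Ω :=
    (hmul t htI s hsI).sub (hmul s hsI t htI)
  rw [integral_const_mul, integral_add i1 i2, integral_sub (hmul s hsI s hsI) (hmul t htI t htI),
    integral_sub (hmul t htI s hsI) (hmul s hsI t htI), hsymm s hs' t ht', sub_self, add_zero,
    slope_def_field, div_eq_inv_mul]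

/-- The energy inequality. -/
theorem integral_integral_mul_nonpos (hT : 0 < T) (hΩ : IsOpen Ω) (hΩb : Bornology.IsBounded Ω)
    (hu : ContinuousOn (Function.uncurry u) (Icc 0 T ×ˢ closure Ω))
    (hv : ContinuousOn (Function.uncurry v) (Icc 0 T ×ˢ closure Ω))
    (hΛ : ContinuousOn (Function.uncurry Λ) (Icc 0 T ×ˢ closure Ω))
    (hd : ∀ x ∈ closure Ω, ∀ t ∈ Icc 0 T,
      HasDerivWithinAt (fun s => u s x) (v t x) (Icc 0 T) t)
    (hu0 : ∀ x ∈ closure Ω, u 0 x = 0)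
    (hsymm : ∀ s ∈ Ioc 0 T, ∀ t ∈ Ioc 0 T, ∫ x in Ω, Λ s x * u t x = ∫ x in Ω, Λ t x * u s x)
    (hneg : ∫ x in Ω, Λ T x * u T x ≤ 0) :
    ∫ t in (0 : ℝ)..T, ∫ x in Ω, Λ t x * v t x ≤ 0 := by
  have hΛu : ContinuousOn (Function.uncurry fun t x => Λ t x * u t x) (Icc 0 T ×ˢ closure Ω) :=
    hΛ.mul hu
  have hΛv : ContinuousOn (Function.uncurry fun t x => 2 * (Λ t x * v t x))
      (Icc 0 T ×ˢ closure Ω) := (hΛ.mul hv).const_mul 2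
  have hE := continuousOn_integral_slice hΩ hΩb hΛu
  have hE' := continuousOn_integral_slice hΩ hΩb hΛv
  -- Twice the double integral is the increment of `∫ Λ u` over `[0, T]`. Its value at `0` vanishes
  -- with `u 0`, and its value at `T` is nonpositive by `hneg`.
  have h := intervalIntegral.integral_eq_sub_of_hasDerivAt_of_le hT.le hE
    (fun t ht => hasDerivAt_integral_mul_of_symm hΩ hΩb hu hv hΛ hd hsymm ht)
    (ContinuousOn.intervalIntegrable (by rwa [uIcc_of_le hT.le]))
  have h0 : ∫ x in Ω, Λ 0 x * u 0 x = 0 := by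
    rw [setIntegral_congr_fun hΩ.measurableSet (g := fun _ => 0)]
    · simp
    · intro x hx
      simp only [hu0 x (subset_closure hx), mul_zero]
  simp only [integral_const_mul, intervalIntegral.integral_const_mul] at h
  rw [h0] at h
  linarith

/-- Vanishing of the velocity and of its fractional derivative for solutions with zero data. -/
theorem eq_zero_of_energy {β κ : ℝ} (hβ₀ : 0 < β) (hβ₁ : β < 1) (hT : 0 < T) (hκ : 0 < κ)
    (hΩ : IsOpen Ω) (hΩb : Bornology.IsBounded Ω)
    {G : ℝ → EuclideanSpace ℝ (Fin N) → ℝ} {f : ℝ → ℝ} {h : EuclideanSpace ℝ (Fin N) → ℝ}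
    (hu : ContinuousOn (Function.uncurry u) (Icc 0 T ×ˢ closure Ω))
    (hv : ContinuousOn (Function.uncurry v) (Icc 0 T ×ˢ closure Ω))
    (hG : ContinuousOn (Function.uncurry G) (Icc 0 T ×ˢ closure Ω))
    (hf : ContinuousOn f (Icc 0 T)) (hh : ContinuousOn h (closure Ω))
    (hd : ∀ x ∈ closure Ω, ∀ t ∈ Icc 0 T,
      HasDerivWithinAt (fun s => u s x) (v t x) (Icc 0 T) t)
    (hu0 : ∀ x ∈ closure Ω, u 0 x = 0)
    (hsymm : ∀ s ∈ Ioc 0 T, ∀ t ∈ Ioc 0 T,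
      ∫ x in Ω, (G s x - f s * h x) * u t x = ∫ x in Ω, (G t x - f t * h x) * u s x)
    (hneg : ∫ x in Ω, (G T x - f T * h x) * u T x ≤ 0)
    (hover : ∀ x ∈ Ω, ∫ t in (0 : ℝ)..T, f t * v t x = 0)
    (habel : ∀ x ∈ Ω, ∀ t ∈ Icc 0 T,
      ∫ τ in (0 : ℝ)..t, v τ x / (t - τ) ^ β = κ * ∫ τ in (0 : ℝ)..t, G τ x) :
    ∀ t ∈ Icc 0 T, ∀ x ∈ Ω, G t x = 0 ∧ v t x = 0 := by
  have hfh : ContinuousOn (Function.uncurry fun t x => f t * h x) (Icc 0 T ×ˢ closure Ω) :=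
    (hf.comp continuousOn_fst fun p hp => hp.1).mul (hh.comp continuousOn_snd fun p hp => hp.2)
  have hΛ : ContinuousOn (Function.uncurry fun t x => G t x - f t * h x)
      (Icc 0 T ×ˢ closure Ω) := hG.sub hfh
  have hGv : ContinuousOn (Function.uncurry fun t x => G t x * v t x) (Icc 0 T ×ˢ closure Ω) :=
    hG.mul hv
  have hΛv : ContinuousOn (Function.uncurry fun t x => (G t x - f t * h x) * v t x)
      (Icc 0 T ×ˢ closure Ω) := hΛ.mul hv
  have hen := integral_integral_mul_nonpos hT hΩ hΩb hu hv hΛ hd hu0 hsymm hneg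
  rw [← (integral_cylinder_swap hT.le hΩb hΛv).2] at hen
  have hcI : ∀ {g : ℝ → ℝ}, ContinuousOn g (Icc 0 T) → IntervalIntegrable g volume 0 T :=
    fun hg => ContinuousOn.intervalIntegrable (by rwa [uIcc_of_le hT.le])
  -- The overdetermination removes the unknown source: `h x` does not depend on `t`, and `∫ f v dt =
  -- 0`.
  have hJ : ∀ x ∈ Ω, ∫ t in (0 : ℝ)..T, (G t x - f t * h x) * v t x =
      ∫ t in (0 : ℝ)..T, G t x * v t x := by
    intro x hx
    have hxc := subset_closure hx
    have e : ∀ t, (G t x - f t * h x) * v t x = G t x * v t x - h x * (f t * v t x) := by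
      intro t; ring
    have hfv : ContinuousOn (fun t => h x * (f t * v t x)) (Icc 0 T) :=
      continuousOn_const.mul (hf.mul (continuousOn_slice_time hv hxc))
    simp_rw [e]
    rw [intervalIntegral.integral_sub (hcI (continuousOn_slice_time hGv hxc)) (hcI hfv),
      intervalIntegral.integral_const_mul, hover x hx, mul_zero, sub_zero]
  rw [setIntegral_congr_fun hΩ.measurableSet hJ] at hen
  have hfrac := fun x (hx : x ∈ Ω) => integral_mul_nonneg_of_abel_primitive hβ₀ hβ₁ hT hκ
    (continuousOn_slice_time hv (subset_closure hx))
    (continuousOn_slice_time hG (subset_closure hx)) (habel x hx)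
  -- The energy inequality meets the pointwise positivity, so the time pairing vanishes for almost
  -- every `x`. Continuity in `x` later removes the exceptional set.
  have hz := le_antisymm hen (setIntegral_nonneg hΩ.measurableSet fun x hx => (hfrac x hx).1)
  have hae := (setIntegral_eq_zero_iff_of_nonneg_ae
    ((ae_restrict_iff' hΩ.measurableSet).2 (Filter.Eventually.of_forall fun x hx =>
      (hfrac x hx).1)) (integral_cylinder_swap hT.le hΩb hGv).1).1 hz
  have hae' : ∀ᵐ x ∂(volume.restrict Ω), ∀ t ∈ Icc 0 T, G t x = 0 ∧ v t x = 0 := by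
    filter_upwards [hae, ae_restrict_mem hΩ.measurableSet] with x hx hxΩ
    exact (hfrac x hxΩ).2 hx
  intro t ht x hx
  have key : ∀ F : ℝ → EuclideanSpace ℝ (Fin N) → ℝ,
      ContinuousOn (Function.uncurry F) (Icc 0 T ×ˢ closure Ω) →
      (∀ᵐ x ∂(volume.restrict Ω), F t x = 0) → F t x = 0 := fun F hF h0 =>
    Measure.eqOn_open_of_ae_eq (g := fun _ => (0 : ℝ)) h0 hΩ
      ((continuousOn_slice_space hF ht).mono subset_closure) continuousOn_const hx
  exact ⟨key G hG (hae'.mono fun x hx => (hx t ht).1), key v hv (hae'.mono fun x hx => (hx t ht).2)⟩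

end Energy

end Cylinder

/-! ### The Caputo primitive and differences of solutions -/

theorem intervalIntegrable_abel {β T t : ℝ} (hβ₁ : β < 1) (ht : t ∈ Icc 0 T) {g : ℝ → ℝ}
    (hg : ContinuousOn g (Icc 0 T)) :
    IntervalIntegrable (fun τ => g τ / (t - τ) ^ β) volume 0 t := by
  have h := (intervalIntegral.intervalIntegrable_rpow' (a := 0) (b := t) (r := -β)
    (by linarith)).comp_sub_left t
  simp only [sub_zero, sub_self] at h
  have hgc : ContinuousOn g (uIcc 0 t) := by
    rw [uIcc_of_le ht.1]
    exact hg.mono (Icc_subset_Icc_right ht.2)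
  refine (h.symm.continuousOn_mul hgc).congr fun τ hτ => ?_
  rw [uIoc_of_le ht.1] at hτ
  rw [Real.rpow_neg (sub_nonneg.2 hτ.2), div_eq_mul_inv]

/-- The fractional integral of the increment of the velocity is the primitive of the Caputo
derivative. -/
theorem caputoPrimitive_eq_integral {E : Type*} {α T : ℝ} (hα₁ : 1 < α) (hα₂ : α < 2)
    (hT : 0 < T) {u : ℝ → E → ℝ} {x : E}
    (hv : ContinuousOn (fun t => timeDeriv T u t x) (Icc 0 T))
    (hd : DifferentiableOn ℝ (caputoPrimitive α T u x) (Ioc 0 T)) {g : ℝ → ℝ}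
    (hg : ContinuousOn g (Icc 0 T)) (hgc : ∀ t ∈ Ioc 0 T, g t = caputo α T u t x) :
    ∀ t ∈ Icc 0 T, caputoPrimitive α T u x t = ∫ τ in (0 : ℝ)..t, g τ := by
  obtain ⟨w, hwc, hw⟩ := exists_continuous_extension_Icc hT.le
    (hv.sub (continuousOn_const (c := timeDeriv T u 0 x)))
  -- Differentiability is given only for `t > 0`. Continuity down to `t = 0`, where the primitive
  -- vanishes, lets the fundamental theorem of calculus start at `0`.
  have hP : ContinuousOn (caputoPrimitive α T u x) (Icc 0 T) := by
    have h := continuousOn_abel (γ := 1 - (2 - α)) (by linarith) (by linarith) hT.le hwc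
    refine (h.const_mul (Real.Gamma (2 - α))⁻¹).congr fun t ht => ?_
    rw [caputoPrimitive, rlIntegral]
    congr 1
    refine intervalIntegral.integral_congr fun τ hτ => ?_
    rw [uIcc_of_le ht.1] at hτ
    simp only [hw ⟨hτ.1, hτ.2.trans ht.2⟩, Pi.sub_apply]
  have hP0 : caputoPrimitive α T u x 0 = 0 := by simp [caputoPrimitive, rlIntegral]
  intro t ht
  have h := intervalIntegral.integral_eq_sub_of_hasDerivAt_of_le ht.1
    (hP.mono (Icc_subset_Icc_right ht.2)) (f' := g) (fun s hs => ?_)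
    (ContinuousOn.intervalIntegrable (by
      rw [uIcc_of_le ht.1]
      exact hg.mono (Icc_subset_Icc_right ht.2)))
  · rw [h, hP0, sub_zero]
  · have hs' : s ∈ Ioo 0 T := ⟨hs.1, hs.2.trans_le ht.2⟩
    have hsd := (hd s (Ioo_subset_Ioc_self hs')).differentiableAt (Ioc_mem_nhds hs'.1 hs'.2)
    rw [hgc s (Ioo_subset_Ioc_self hs'), caputo,
      derivWithin_of_mem_nhds (Icc_mem_nhds hs'.1 hs'.2)]
    exact hsd.hasDerivAt

section Application

variable {N : ℕ} {Ω : Set (EuclideanSpace ℝ (Fin N))}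
  {A : EuclideanSpace ℝ (Fin N) → Matrix (Fin N) (Fin N) ℝ}
  {c u w : EuclideanSpace ℝ (Fin N) → ℝ}

theorem partialDeriv_congr {x : EuclideanSpace ℝ (Fin N)} (h : u =ᶠ[nhds x] w) (i : Fin N) :
    partialDeriv i u x = partialDeriv i w x := by
  rw [partialDeriv, partialDeriv, h.fderiv_eq]

theorem partialDeriv_sub {x : EuclideanSpace ℝ (Fin N)} (hu : DifferentiableAt ℝ u x)
    (hw : DifferentiableAt ℝ w x) (i : Fin N) :
    partialDeriv i (fun y => u y - w y) x = partialDeriv i u x - partialDeriv i w x := by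
  rw [partialDeriv, fderiv_fun_sub hu hw]
  rfl

theorem ellipticOp_sub (hΩ : IsOpen Ω) (hA : ∀ i j, ContDiffOn ℝ 1 (fun x => A x i j) Ω)
    (hu : ContDiffOn ℝ 2 u Ω) (hw : ContDiffOn ℝ 2 w Ω) {x : EuclideanSpace ℝ (Fin N)}
    (hx : x ∈ Ω) :
    ellipticOp A c (fun y => u y - w y) x = ellipticOp A c u x - ellipticOp A c w x := by
  have hd : ∀ {g : EuclideanSpace ℝ (Fin N) → ℝ} {n : WithTop ℕ∞}, n ≠ 0 → ContDiffOn ℝ n g Ω →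
      ∀ y ∈ Ω, DifferentiableAt ℝ g y := fun hn hg y hy =>
    (hg.contDiffAt (hΩ.mem_nhds hy)).differentiableAt hn
  have hflux : ∀ i, ∀ y ∈ Ω, flux A (fun y => u y - w y) i y = flux A u i y - flux A w i y := by
    intro i y hy
    simp only [flux, ← Finset.sum_sub_distrib, ← mul_sub]
    refine Finset.sum_congr rfl fun j _ => ?_
    rw [partialDeriv_sub (hd two_ne_zero hu y hy) (hd two_ne_zero hw y hy)]
  have hdiv : divFlux A (fun y => u y - w y) x = divFlux A u x - divFlux A w x := by
    simp only [divFlux, ← Finset.sum_sub_distrib]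
    refine Finset.sum_congr rfl fun i _ => ?_
    rw [← partialDeriv_sub (hd one_ne_zero (contDiffOn_flux hΩ hA hu i) x hx)
      (hd one_ne_zero (contDiffOn_flux hΩ hA hw i) x hx)]
    refine partialDeriv_congr ?_ i
    filter_upwards [hΩ.mem_nhds hx] with y hy using hflux i y hy
  rw [ellipticOp_eq, ellipticOp_eq, ellipticOp_eq, hdiv]
  ring

theorem ellipticOp_eq_zero (hΩ : IsOpen Ω) (hu : ∀ x ∈ Ω, u x = 0)
    {x : EuclideanSpace ℝ (Fin N)} (hx : x ∈ Ω) : ellipticOp A c u x = 0 := by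
  have hp : ∀ {g : EuclideanSpace ℝ (Fin N) → ℝ}, (∀ y ∈ Ω, g y = 0) → ∀ i, ∀ y ∈ Ω,
      partialDeriv i g y = 0 := by
    intro g hg i y hy
    rw [partialDeriv_congr (w := fun _ => 0)
      (by filter_upwards [hΩ.mem_nhds hy] with z hz using hg z hz)]
    simp [partialDeriv]
  have hflux : ∀ i, ∀ y ∈ Ω, flux A u i y = 0 := fun i y hy =>
    Finset.sum_eq_zero fun j _ => by rw [hp hu j y hy, mul_zero]
  rw [ellipticOp_eq, hu x hx, mul_zero, sub_zero]
  exact Finset.sum_eq_zero fun i _ => hp (hflux i) i x hx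

/-- The equation expresses `div (A ∇u)` as `Λ + c u`, continuous on the compact closure and hence
bounded. Green's identity needs no other control of derivatives near the boundary. -/
theorem isDirichlet_of_ellipticOp (hΩb : Bornology.IsBounded Ω)
    (hc : ContinuousOn c (closure Ω)) (hu : ContDiffOn ℝ 2 u Ω)
    (huc : ContinuousOn u (closure Ω)) (hu0 : ∀ x ∈ frontier Ω, u x = 0)
    {Λ : EuclideanSpace ℝ (Fin N) → ℝ} (hΛ : ContinuousOn Λ (closure Ω))
    (hL : ∀ x ∈ Ω, ellipticOp A c u x = Λ x) : IsDirichlet A Ω u := by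
  obtain ⟨M, hM⟩ := hΩb.isCompact_closure.exists_bound_of_continuousOn (hΛ.add (hc.mul huc))
  refine ⟨hu, huc, hu0, M, fun x hx => ?_⟩
  have h := hL x hx
  rw [ellipticOp_eq] at h
  rw [show divFlux A u x = Λ x + c x * u x by linarith]
  exact hM x (subset_closure hx)

end Application

end FracWave

/-! ### Uniqueness for the inverse problem -/

open FracWave

theorem theorem5 {N : ℕ} (hN : 1 ≤ N) (α T δ : ℝ) (hα₁ : 1 < α) (hα₂ : α < 2) (hT : 0 < T)
    (Ω : Set (EuclideanSpace ℝ (Fin N))) (hΩ_open : IsOpen Ω)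
    (hΩ_bdd : Bornology.IsBounded Ω)
    (A : EuclideanSpace ℝ (Fin N) → Matrix (Fin N) (Fin N) ℝ)
    (hA_symm : ∀ x ∈ Ω, (A x).IsSymm)
    (hA_cont : ∀ i j, ContinuousOn (fun x => A x i j) (closure Ω))
    (hA_diff : ∀ i j, ContDiffOn ℝ 1 (fun x => A x i j) Ω)
    (hδ : 0 < δ)
    (hA_elliptic : ∀ x ∈ Ω, ∀ ξ : Fin N → ℝ,
      δ * ∑ i, ξ i ^ 2 ≤ ∑ i, ∑ j, A x i j * ξ i * ξ j)
    (c : EuclideanSpace ℝ (Fin N) → ℝ) (hc_cont : ContinuousOn c (closure Ω))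
    (hc_nonneg : ∀ x ∈ Ω, 0 ≤ c x)
    (f : ℝ → ℝ) (hf_cont : ContinuousOn f (Set.Icc 0 T)) (hf : ∃ t ∈ Set.Icc 0 T, f t ≠ 0)
    (φ ψ ω : EuclideanSpace ℝ (Fin N) → ℝ)
    (u₁ u₂ : ℝ → EuclideanSpace ℝ (Fin N) → ℝ) (h₁ h₂ : EuclideanSpace ℝ (Fin N) → ℝ)
    (hsol₁ : FracWave.IsSolutionIP2 α T Ω A c φ ψ f ω u₁ h₁)
    (hsol₂ : FracWave.IsSolutionIP2 α T Ω A c φ ψ f ω u₂ h₂) :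
    (∀ t ∈ Set.Icc 0 T, ∀ x ∈ closure Ω, u₁ t x = u₂ t x) ∧
      ∀ x ∈ closure Ω, h₁ x = h₂ x := by
  have hpos : ∀ x ∈ Ω, ∀ ξ : Fin N → ℝ, 0 ≤ ∑ i, ∑ j, A x i j * ξ i * ξ j := fun x hx ξ =>
    (mul_nonneg hδ.le (Finset.sum_nonneg fun i _ => sq_nonneg _)).trans (hA_elliptic x hx ξ)
  obtain ⟨G₁, hG₁c, hG₁⟩ := hsol₁.mem_u.cont_caputo
  obtain ⟨G₂, hG₂c, hG₂⟩ := hsol₂.mem_u.cont_caputo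
  set u : ℝ → EuclideanSpace ℝ (Fin N) → ℝ := fun t x => u₁ t x - u₂ t x with hu
  set v : ℝ → EuclideanSpace ℝ (Fin N) → ℝ :=
    fun t x => timeDeriv T u₁ t x - timeDeriv T u₂ t x with hv
  set G : ℝ → EuclideanSpace ℝ (Fin N) → ℝ := fun t x => G₁ t x - G₂ t x with hG
  set h : EuclideanSpace ℝ (Fin N) → ℝ := fun x => h₁ x - h₂ x with hh
  have huc : ContinuousOn (Function.uncurry u) (Icc 0 T ×ˢ closure Ω) :=
    hsol₁.mem_u.cont.sub hsol₂.mem_u.cont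
  have hvc : ContinuousOn (Function.uncurry v) (Icc 0 T ×ˢ closure Ω) :=
    hsol₁.mem_u.cont_timeDeriv.sub hsol₂.mem_u.cont_timeDeriv
  have hGc : ContinuousOn (Function.uncurry G) (Icc 0 T ×ˢ closure Ω) := hG₁c.sub hG₂c
  have hhc : ContinuousOn h (closure Ω) := hsol₁.mem_h.sub hsol₂.mem_h
  have hd : ∀ x ∈ closure Ω, ∀ t ∈ Icc 0 T,
      HasDerivWithinAt (fun s => u s x) (v t x) (Icc 0 T) t := fun x hx t ht =>
    ((hsol₁.mem_u.diff x hx t ht).hasDerivWithinAt).sub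
      ((hsol₂.mem_u.diff x hx t ht).hasDerivWithinAt)
  have hu0 : ∀ x ∈ closure Ω, u 0 x = 0 := fun x hx => by
    simp only [hu, hsol₁.initial x hx, hsol₂.initial x hx, sub_self]
  have huC2 : ∀ t ∈ Ioc 0 T, ContDiffOn ℝ 2 (u t) Ω := fun t ht =>
    (hsol₁.mem_u.contDiff_space t ht).sub (hsol₂.mem_u.contDiff_space t ht)
  have hL : ∀ t ∈ Ioc 0 T, ∀ x ∈ Ω, ellipticOp A c (u t) x = G t x - f t * h x := by
    intro t ht x hx
    rw [hu, ellipticOp_sub hΩ_open hA_diff (hsol₁.mem_u.contDiff_space t ht)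
      (hsol₂.mem_u.contDiff_space t ht) hx]
    have e₁ := hsol₁.equation t ht x hx
    have e₂ := hsol₂.equation t ht x hx
    simp only [hG, hh, hG₁ t ht x hx, hG₂ t ht x hx]
    linear_combination e₂ - e₁
  have hDir : ∀ t ∈ Ioc 0 T, IsDirichlet A Ω (u t) := by
    intro t ht
    have ht' := Ioc_subset_Icc_self ht
    refine isDirichlet_of_ellipticOp hΩ_bdd hc_cont (huC2 t ht) (continuousOn_slice_space huc ht')
      (fun x hx => ?_) ((continuousOn_slice_space hGc ht').sub (hhc.const_mul (f t))) (hL t ht)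
    simp only [hu, hsol₁.boundary t ht' x hx, hsol₂.boundary t ht' x hx, sub_self]
  have hpair : ∀ s ∈ Ioc 0 T, ∀ t, ∫ x in Ω, (G s x - f s * h x) * u t x =
      ∫ x in Ω, ellipticOp A c (u s) x * u t x := fun s hs t =>
    setIntegral_congr_fun hΩ_open.measurableSet fun x hx => by simp only [hL s hs x hx]
  have hTmem : T ∈ Ioc 0 T := right_mem_Ioc.2 hT
  have hΓ : 0 < Real.Gamma (2 - α) := Real.Gamma_pos_of_pos (by linarith)
  -- Both solutions have initial velocity `ψ`, which cancels in the difference, leaving the Abel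
  -- integral of `v` itself with exponent `1 - (2 - α) = α - 1` in `(0, 1)`.
  have habel : ∀ x ∈ Ω, ∀ t ∈ Icc 0 T, ∫ τ in (0 : ℝ)..t, v τ x / (t - τ) ^ (1 - (2 - α)) =
      Real.Gamma (2 - α) * ∫ τ in (0 : ℝ)..t, G τ x := by
    intro x hx t ht
    have hxc := subset_closure hx
    have key : ∀ {u : ℝ → EuclideanSpace ℝ (Fin N) → ℝ} {h : EuclideanSpace ℝ (Fin N) → ℝ}
        {G : ℝ → EuclideanSpace ℝ (Fin N) → ℝ}, IsSolutionIP2 α T Ω A c φ ψ f ω u h →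
        ContinuousOn (Function.uncurry G) (Icc 0 T ×ˢ closure Ω) →
        (∀ t ∈ Ioc 0 T, ∀ x ∈ Ω, G t x = caputo α T u t x) →
        IntervalIntegrable (fun τ => (timeDeriv T u τ x - ψ x) / (t - τ) ^ (1 - (2 - α)))
          volume 0 t ∧
        ∫ τ in (0 : ℝ)..t, (timeDeriv T u τ x - ψ x) / (t - τ) ^ (1 - (2 - α)) =
          Real.Gamma (2 - α) * ∫ τ in (0 : ℝ)..t, G τ x := by
      intro u h G hsol hGc hG
      have hvc := continuousOn_slice_time hsol.mem_u.cont_timeDeriv hxc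
      refine ⟨intervalIntegrable_abel (by linarith) ht (hvc.sub continuousOn_const), ?_⟩
      have e := caputoPrimitive_eq_integral hα₁ hα₂ hT hvc (hsol.mem_u.diff_caputo x hx)
        (continuousOn_slice_time hGc hxc) (fun s hs => hG s hs x hx) t ht
      rw [caputoPrimitive, rlIntegral, hsol.initial_velocity x hxc] at e
      rw [← e, mul_inv_cancel_left₀ hΓ.ne']
    obtain ⟨i₁, e₁⟩ := key hsol₁ hG₁c hG₁
    obtain ⟨i₂, e₂⟩ := key hsol₂ hG₂c hG₂
    have hGi : ∀ {G : ℝ → EuclideanSpace ℝ (Fin N) → ℝ},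
        ContinuousOn (Function.uncurry G) (Icc 0 T ×ˢ closure Ω) →
        IntervalIntegrable (fun τ => G τ x) volume 0 t := fun hG =>
      ContinuousOn.intervalIntegrable (by
        rw [uIcc_of_le ht.1]
        exact (continuousOn_slice_time hG hxc).mono (Icc_subset_Icc_right ht.2))
    have e : ∀ τ, v τ x / (t - τ) ^ (1 - (2 - α)) =
        (timeDeriv T u₁ τ x - ψ x) / (t - τ) ^ (1 - (2 - α)) -
          (timeDeriv T u₂ τ x - ψ x) / (t - τ) ^ (1 - (2 - α)) := by
      intro τ
      rw [← sub_div, sub_sub_sub_cancel_right]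
    simp_rw [e]
    rw [intervalIntegral.integral_sub i₁ i₂, e₁, e₂, ← mul_sub,
      intervalIntegral.integral_sub (hGi hG₁c) (hGi hG₂c)]
  have hover : ∀ x ∈ Ω, ∫ t in (0 : ℝ)..T, f t * v t x = 0 := by
    intro x hx
    have hxc := subset_closure hx
    have hi : ∀ {u : ℝ → EuclideanSpace ℝ (Fin N) → ℝ}, MemC10 T Ω u →
        IntervalIntegrable (fun t => f t * timeDeriv T u t x) volume 0 T := fun hu =>
      ContinuousOn.intervalIntegrable (by
        rw [uIcc_of_le hT.le]
        exact hf_cont.mul (continuousOn_slice_time hu.cont_timeDeriv hxc))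
    simp only [hv, mul_sub]
    rw [intervalIntegral.integral_sub (hi hsol₁.mem_u.toMemC10) (hi hsol₂.mem_u.toMemC10),
      hsol₁.overdetermination x hxc, hsol₂.overdetermination x hxc, sub_self]
  have hzero := eq_zero_of_energy (β := 1 - (2 - α)) (by linarith) (by linarith) hT hΓ hΩ_open
    hΩ_bdd huc hvc hGc hf_cont hhc hd hu0
    (fun s hs t ht => by
      rw [hpair s hs, hpair t ht]
      exact integral_ellipticOp_mul_comm hΩ_open hΩ_bdd hA_diff hA_symm hpos hc_cont
        (hDir s hs) (hDir t ht))
    (by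
      rw [hpair T hTmem]
      exact integral_ellipticOp_mul_self_nonpos hΩ_open hΩ_bdd hA_diff hA_symm hpos hc_cont
        hc_nonneg (hDir T hTmem))
    hover habel
  have huΩ : ∀ t ∈ Icc 0 T, ∀ x ∈ Ω, u t x = 0 := by
    intro t ht x hx
    have hxc := subset_closure hx
    rw [← hu0 x hxc]
    refine constant_of_derivWithin_zero (f := fun s => u s x)
      (fun s hs => (hd x hxc s hs).differentiableWithinAt) (fun s hs => ?_) t ht
    have hs' := Ico_subset_Icc_self hs
    rw [(hd x hxc s hs').derivWithin (uniqueDiffOn_Icc hT s hs'), (hzero s hs' x hx).2]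
  constructor
  · intro t ht x hx
    have h0 : EqOn (u t) (fun _ => 0) (closure Ω) :=
      EqOn.of_subset_closure (huΩ t ht) (continuousOn_slice_space huc ht) continuousOn_const
        subset_closure subset_rfl
    exact sub_eq_zero.1 (h0 hx)
  -- The equation is available only for `t > 0`. If `f` vanished on `(0, T]`, it would vanish at `0`
  -- too by continuity.
  · obtain ⟨t, ht, hft⟩ : ∃ t ∈ Ioc 0 T, f t ≠ 0 := by
      by_contra! hne
      obtain ⟨t, ht, hft⟩ := hf
      have h0 : EqOn f (fun _ => 0) (Icc 0 T) :=
        EqOn.of_subset_closure hne hf_cont continuousOn_const Ioc_subset_Icc_self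
          (closure_Ioc hT.ne).symm.subset
      exact hft (h0 ht)
    have hhΩ : EqOn h (fun _ => 0) Ω := by
      intro x hx
      have ht' := Ioc_subset_Icc_self ht
      have e := hL t ht x hx
      rw [ellipticOp_eq_zero hΩ_open (huΩ t ht') hx, (hzero t ht' x hx).1, zero_sub] at e
      exact (mul_eq_zero.1 (neg_eq_zero.1 e.symm)).resolve_left hft
    intro x hx
    have h0 : EqOn h (fun _ => 0) (closure Ω) :=
      EqOn.of_subset_closure hhΩ hhc continuousOn_const subset_closure subset_rfl
    exact sub_eq_zero.1 (h0 hx)
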